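/- **Setting.** Call $f:\mathbb{R}\to[0,\infty)$ *admissible* if it is a probability density vanishing outside $[0,1]$, continuous on $[0,1]$, which has exactly one mode (global maximizer) $\mathrm{mode}(f)$, and is such that $f$ is twice differentiable in a neighbourhood of $\mathrm{mode}(f)$ in $\mathbb{R}$ with $f''(\mathrm{mode}(f))<0$. For a finite sample $S=(x_1,\dots,x_m)$ put $r_k(x)=\inf\{r:\ |\{j: |x_j-x|\le r\}|\ge k\}$; a *sample mode* of $S$ is any sample point minimizing $r_k$ over the sample points, with $k=m^{4/5}$. There are $K\ge 1$ arms. The rewards of arm $i$ have density $f_i$, where $f_i$ is admissible, and $\theta_i=\mathrm{mode}(f_i)$; the $s$-th pull of arm $i$ yields a reward $X_{i,s}$, and the $X_{i,s}$ are all independent. *Uniform sampling* for $n$ rounds means that in each round an arm is pulled that has been pulled least often so far, ties being broken arbitrarily. Let $\hat\theta_i$ be a sample mode of the rewards observed from arm $i$ in the $n$ rounds. An arm $i$ is $\varepsilon$-*optimal* if $\max_j\theta_j-\theta_i\le\varepsilon$. **Theorem ($\varepsilon$-optimal arm identification).** One can assign to every admissible density $f$ a natural number $N_f$, depending on $f$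 only, such that the following holds for all $K\ge1$, all admissible $f_1,\dots,f_K$, all $\varepsilon>0$ and all $\delta\in(0,1)$. If the arms are sampled uniformly for $$ n\ \ge\ \max\Big\{K\,\big(\log K+\log(1/\delta)\big)^5\,\varepsilon^{-5}\,\log(\varepsilon^{-5}),\ \ K\max_{1\le i\le K}N_{f_i}\Big\} $$ rounds, then the arm with the highest sample mode $\hat\theta_i$ (any such arm, if there are several) is $\varepsilon$-optimal with probability at least $1-\delta$. -/

import Mathlib

open MeasureTheory ProbabilityTheory Filter Topology Set

namespace ModalBandit

/-- `x` is a mode of the density `f`: a global maximizer. -/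
def IsMode (f : ℝ → ℝ) (x : ℝ) : Prop := ∀ y, f y ≤ f x

/-- `f` is a probability density on `[0, 1]` (extended by zero to the real line), continuous on
`[0, 1]`, with exactly one mode; around the mode `f` is twice differentiable, and its second
derivative at the mode is negative. -/
structure IsModalDensity (f : ℝ → ℝ) : Prop where
  nonneg : ∀ x, 0 ≤ f x
  eq_zero_of_notMem : ∀ x, x ∉ Icc (0 : ℝ) 1 → f x = 0
  integral_eq_one : ∫ x, f x = 1
  continuousOn : ContinuousOn f (Icc 0 1)
  existsUnique_mode : ∃! x, IsMode f x
  twice_differentiable : ∀ x, IsMode f x →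
    ∀ᶠ y in 𝓝 x, DifferentiableAt ℝ f y ∧ DifferentiableAt ℝ (deriv f) y
  hessian_neg : ∀ x, IsMode f x → deriv (deriv f) x < 0

/-- The distribution with density `f`. -/
noncomputable def law (f : ℝ → ℝ) : Measure ℝ :=
  volume.withDensity fun x => ENNReal.ofReal (f x)

/-- The `k`-nearest-neighbour radius `r_k(y)` of the sample `S`: the infimum of the `r` such that
the closed ball `B(y, r)` contains at least `k` sample points. -/
noncomputable def knnRadius {m : ℕ} (S : Fin m → ℝ) (k : ℝ) (y : ℝ) : ℝ :=
  sInf {r : ℝ | k ≤ ((Finset.univ.filter fun j => |S j - y| ≤ r).card : ℝ)}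

/-- `z` is a sample mode of `S`: a point of the sample with the smallest `k`-nearest-neighbour
radius among all points of the sample, where `k = m ^ (4 / 5)` and `m` is the sample size.
The minimizer need not be unique. -/
def IsSampleMode {m : ℕ} (S : Fin m → ℝ) (z : ℝ) : Prop :=
  ∃ j, z = S j ∧ ∀ l, knnRadius S ((m : ℝ) ^ (4 / 5 : ℝ)) (S j) ≤
    knnRadius S ((m : ℝ) ^ (4 / 5 : ℝ)) (S l)

/-- The number of pulls of arm `i` in the first `t` rounds, if `I s` is the arm pulled in
round `s + 1`. -/
def pullCount {K : ℕ} (I : ℕ → Fin K) (i : Fin K) (t : ℕ) : ℕ :=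
  ((Finset.range t).filter fun s => I s = i).card

/-- `I` is a run of the uniform sampling strategy over `n` rounds: each round pulls an arm that has
been pulled least often so far, ties being broken arbitrarily. -/
def IsUniformSampling {K : ℕ} (I : ℕ → Fin K) (n : ℕ) : Prop :=
  ∀ t < n, ∀ j, pullCount I (I t) t ≤ pullCount I j t

/-- The rewards observed from arm `i` in the first `n` rounds, where the `s`-th pull of
arm `i` (counted from zero) yields the reward `X i s`. -/
def observed {K : ℕ} (X : Fin K → ℕ → ℝ) (I : ℕ → Fin K) (n : ℕ) (i : Fin K) :
    Fin (pullCount I i n) → ℝ :=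
  fun s => X i s

end ModalBandit

/-!
Each sample mode is shown to be within `ε / 2` of the mode of its arm except with probability `δ / K`;
the arm with the highest sample mode is then `ε`-optimal. Put `m = g ^ 5` for the number of rewards
of the arm, so that `k = g ^ 4` and a `k`-nearest-neighbour ball has mass about `1 / g`, and let
`T = ε * g`. The claim needed per arm is a failure probability of at most `exp (-T ^ 2) / 2` for
large `T` (`IsModalDensity.exists_hasModeTail`).

Near the mode `θ` the density lies between two parabolas `f θ * (1 - c * (x - θ) ^ 2)` and
`f θ * (1 - β * (x - θ) ^ 2)`, the upper one extending to all relevant `x` because the mode is unique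
(`IsModalDensity.exists_quadratic_bounds`). Hence a ball of the right radius about a sample point
very close to `θ` has mass above `1 / g` by a relative margin of order `ε ^ 2`, while a slightly
larger ball about a point at distance `w > ε` has mass below `1 / g` by a relative margin of order
`w ^ 2`. If the empirical counts respect these margins, no far sample point can be a sample mode
(`IsSampleMode.abs_sub_le`).

A count of order `k` deviates by a relative margin `w ^ 2` with probability
`exp (-const * k * w ^ 4)`, which is `exp (-const * T ^ 4)` at `w = ε`. A union bound over all sample
points would cost a factor `m`, and the assumed sample size does not pay for it: `T ^ 4` may be as
small as a multiple of `(log m) ^ (4 / 5)`. A grid in two levels avoids the loss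
(`exists_grid_cover`, `Regime.hits_outer_lt`). Balls are compared with intervals that start on a
coarse grid of mesh `1 / (g * log m)`; the sum over this grid converges up to a power of `log m`
thanks to the quadratic growth of the margin (`Regime.sum_exp_le`). What is left over are intervals
inside one coarse cell, whose smaller mass improves the exponent by a factor `log m`, enough for a
union bound over a fine grid of polynomial size (`Regime.measureReal_edge_le`).

Finally `T ^ 5 = (ε / 2) ^ 5 * m` is bounded below by a multiple of `L ^ 5 * log (ε ^ (-5))` with
`L = log (K / δ) ≥ log 2`, so `T ^ 2 ≥ L` when `T` is large (`scale_bounds`). For `ε` close to `1` the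
logarithm is small, but then `1 - ε` is at least the distance of the best mode to `1`, and the
threshold of the best arm compensates for it.
-/

namespace ModalBandit

/-! ### Densities near their mode -/

theorem IsModalDensity.apply_mode_pos {f : ℝ → ℝ} (hf : IsModalDensity f) {θ : ℝ}
    (hθ : IsMode f θ) : 0 < f θ := by
  refine lt_of_le_of_ne (hf.nonneg θ) fun h => ?_
  have h0 : f = fun _ => 0 := funext fun x => le_antisymm (h ▸ hθ x) (hf.nonneg x)
  have h1 := hf.integral_eq_one
  simp [h0] at h1

/-- A density that is differentiable at its mode is continuous there, so the mode cannot be an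
endpoint of the support interval. -/
theorem IsModalDensity.mode_mem_Ioo {f : ℝ → ℝ} (hf : IsModalDensity f) {θ : ℝ}
    (hθ : IsMode f θ) : θ ∈ Ioo (0 : ℝ) 1 := by
  have hpos := hf.apply_mode_pos hθ
  have hcont : ContinuousAt f θ :=
    ((hf.twice_differentiable θ hθ).self_of_nhds).1.continuousAt
  have hev : ∀ᶠ y in 𝓝 θ, y ∈ Icc (0 : ℝ) 1 := by
    filter_upwards [hcont.eventually (lt_mem_nhds hpos)] with y hy
    by_contra h
    exact hy.ne' (hf.eq_zero_of_notMem y h)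
  have := mem_interior_iff_mem_nhds.2 (show Icc (0 : ℝ) 1 ∈ 𝓝 θ from hev)
  rwa [interior_Icc] at this

/-- Second-order behaviour at the mode, via Cauchy's mean value theorem for `f` against the
square of the distance to the mode. -/
theorem IsModalDensity.eventually_quadratic {f : ℝ → ℝ} (hf : IsModalDensity f) {θ : ℝ}
    (hθ : IsMode f θ) : ∃ a > 0, ∃ r > 0, ∀ x, |x - θ| < r →
      f θ - 3 * a * (x - θ) ^ 2 ≤ f x ∧ f x ≤ f θ - a * (x - θ) ^ 2 := by
  set b := -deriv (deriv f) θ with hb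
  have hb0 : 0 < b := by have := hf.hessian_neg θ hθ; linarith
  have hd0 : deriv f θ = 0 := by
    refine IsLocalMax.deriv_eq_zero ?_
    exact Eventually.of_forall hθ
  have hder : HasDerivAt (deriv f) (-b) θ := by
    rw [hb, neg_neg]
    exact ((hf.twice_differentiable θ hθ).self_of_nhds).2.hasDerivAt
  have hlo := hder.isLittleO.def (half_pos hb0)
  obtain ⟨r, hr, hball⟩ := Metric.eventually_nhds_iff.1
    (hlo.and (hf.twice_differentiable θ hθ))
  refine ⟨b / 4, by positivity, r, hr, fun x hx => ?_⟩
  have key : ∃ t ∈ Ioo (0 : ℝ) 1,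
      ((1 : ℝ) ^ 2 - 0 ^ 2) * (deriv f (θ + t * (x - θ)) * (x - θ)) =
      (f (θ + 1 * (x - θ)) - f (θ + 0 * (x - θ))) * (2 * t) := by
    have hdiff : ∀ t ∈ Icc (0 : ℝ) 1,
        HasDerivAt (fun t => f (θ + t * (x - θ))) (deriv f (θ + t * (x - θ)) * (x - θ)) t := by
      intro t ht
      have hin : dist (θ + t * (x - θ)) θ < r := by
        rw [Real.dist_eq]
        have : |θ + t * (x - θ) - θ| = t * |x - θ| := by
          rw [add_sub_cancel_left, abs_mul, abs_of_nonneg ht.1]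
        rw [this]
        nlinarith [abs_nonneg (x - θ), ht.2]
      have h1 : HasDerivAt (fun t : ℝ => θ + t * (x - θ)) (x - θ) t := by
        simpa using ((hasDerivAt_id t).mul_const (x - θ)).const_add θ
      exact (hball hin).2.1.hasDerivAt.comp t h1
    refine exists_ratio_hasDerivAt_eq_ratio_slope (fun t => f (θ + t * (x - θ)))
      (fun t => deriv f (θ + t * (x - θ)) * (x - θ)) zero_lt_one
      (fun t ht => (hdiff t ht).continuousAt.continuousWithinAt)
      (fun t ht => hdiff t ⟨ht.1.le, ht.2.le⟩) (fun t => t ^ 2) (fun t => 2 * t)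
      (by fun_prop) (fun t _ => by simpa using hasDerivAt_pow 2 t)
  obtain ⟨t, ht, hkey⟩ := key
  have hin : dist (θ + t * (x - θ)) θ < r := by
    rw [Real.dist_eq]
    have : |θ + t * (x - θ) - θ| = t * |x - θ| := by
      rw [add_sub_cancel_left, abs_mul, abs_of_nonneg ht.1.le]
    rw [this]
    nlinarith [abs_nonneg (x - θ), ht.2]
  have h2 := (hball hin).1
  rw [hd0, Real.norm_eq_abs, Real.norm_eq_abs] at h2
  simp only [sub_zero, add_sub_cancel_left, smul_eq_mul] at h2
  -- multiplying by the increment removes the sign of `x - θ`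
  have h3 : |(deriv f (θ + t * (x - θ)) - t * (x - θ) * -b) * (x - θ)|
      ≤ b / 2 * (t * (x - θ) ^ 2) := by
    rw [abs_mul]
    calc _ ≤ b / 2 * |t * (x - θ)| * |x - θ| := by gcongr
      _ = b / 2 * (t * (x - θ) ^ 2) := by
        rw [abs_mul, abs_of_pos ht.1, ← sq_abs (x - θ)]; ring
  rw [abs_le] at h3
  have e : f (θ + 1 * (x - θ)) - f (θ + 0 * (x - θ)) = f x - f θ := by
    congr 2 <;> ring
  rw [e] at hkey
  have ht0 := ht.1
  constructor
  · have : 0 ≤ t * (f x - (f θ - 3 * (b / 4) * (x - θ) ^ 2)) := by nlinarith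
    linarith [nonneg_of_mul_nonneg_right this ht0]
  · have : 0 ≤ t * ((f θ - b / 4 * (x - θ) ^ 2) - f x) := by nlinarith
    linarith [nonneg_of_mul_nonneg_right this ht0]

/-- Away from the mode the density stays below its maximum by a fixed amount. -/
theorem IsModalDensity.exists_gap {f : ℝ → ℝ} (hf : IsModalDensity f) {θ : ℝ}
    (hθ : IsMode f θ) {r : ℝ} (hr : 0 < r) :
    ∃ γ > 0, ∀ x ∈ Icc (0 : ℝ) 1, r ≤ |x - θ| → f x ≤ f θ - γ := by
  set s : Set ℝ := Icc 0 1 ∩ {x | r ≤ |x - θ|} with hs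
  have hcpt : IsCompact s := isCompact_Icc.inter_right
    (isClosed_le continuous_const (by fun_prop))
  rcases s.eq_empty_or_nonempty with he | hne
  · exact ⟨1, one_pos, fun x hx hx' => (eq_empty_iff_forall_notMem.1 he x ⟨hx, hx'⟩).elim⟩
  · obtain ⟨y, hy, hmax⟩ := hcpt.exists_isMaxOn hne (hf.continuousOn.mono inter_subset_left)
    refine ⟨f θ - f y, ?_, fun x hx hx' => ?_⟩
    · refine sub_pos.2 (lt_of_le_of_ne (hθ y) fun h => ?_)
      have hyθ : y = θ := hf.existsUnique_mode.unique (fun z => h ▸ hθ z) hθ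
      have := hy.2
      simp [hyθ] at this
      linarith
    · have := hmax (⟨hx, hx'⟩ : x ∈ s)
      simp only [mem_ofPred_eq] at this
      linarith

/-- Global quadratic bounds for an admissible density, normalized by its maximum. The upper bound
cannot hold on the whole line, as `f` is nonnegative; radius `4` around the mode leaves room for
all intervals that meet `[0, 1]`. -/
theorem IsModalDensity.exists_quadratic_bounds {f : ℝ → ℝ} (hf : IsModalDensity f) {θ : ℝ}
    (hθ : IsMode f θ) : ∃ β > 0, β ≤ 1 / 16 ∧ ∃ c > 0,
      (∀ x, |x - θ| ≤ 4 → f x ≤ f θ * (1 - β * (x - θ) ^ 2)) ∧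
      ∀ x, f θ * (1 - c * (x - θ) ^ 2) ≤ f x := by
  have hM := hf.apply_mode_pos hθ
  obtain ⟨a, ha, r, hr, hq⟩ := hf.eventually_quadratic hθ
  obtain ⟨γ, hγ, hgap⟩ := hf.exists_gap hθ hr
  set M := f θ
  refine ⟨min (a / M) (min (γ / (16 * M)) (1 / 16)), by positivity,
    (min_le_right _ _).trans (min_le_right _ _), max (3 * a / M) (1 / r ^ 2), by positivity,
    fun x hx => ?_, fun x => ?_⟩
  · set β := min (a / M) (min (γ / (16 * M)) (1 / 16))
    have h1 : β * M ≤ a := (le_div_iff₀ hM).1 (min_le_left _ _)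
    have h2 : β * (16 * M) ≤ γ :=
      (le_div_iff₀ (by positivity)).1 ((min_le_right _ _).trans (min_le_left _ _))
    have h3 : β ≤ 1 / 16 := (min_le_right _ _).trans (min_le_right _ _)
    have hx16 : (x - θ) ^ 2 ≤ 16 := by
      rw [← sq_abs]; nlinarith [abs_nonneg (x - θ)]
    have hβ : 0 ≤ β := by positivity
    by_cases hxr : |x - θ| < r
    · have := (hq x hxr).2
      nlinarith [sq_nonneg (x - θ)]
    · by_cases hx01 : x ∈ Icc (0 : ℝ) 1
      · have := hgap x hx01 (not_lt.1 hxr)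
        nlinarith [mul_nonneg hβ hM.le]
      · rw [hf.eq_zero_of_notMem x hx01]
        have : β * (x - θ) ^ 2 ≤ 1 := by nlinarith [sq_nonneg (x - θ)]
        exact mul_nonneg hM.le (by linarith)
  · set c := max (3 * a / M) (1 / r ^ 2)
    have h1 : 3 * a ≤ c * M := (div_le_iff₀ hM).1 (le_max_left _ _)
    have h2 : 1 ≤ c * r ^ 2 := (div_le_iff₀ (by positivity)).1 (le_max_right _ _)
    by_cases hxr : |x - θ| < r
    · have := (hq x hxr).1
      nlinarith [sq_nonneg (x - θ)]
    · have h4 : r ^ 2 ≤ (x - θ) ^ 2 := by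
        rw [← sq_abs (x - θ)]; nlinarith [not_lt.1 hxr]
      have : 1 ≤ c * (x - θ) ^ 2 := h2.trans (by gcongr)
      have h5 : M * (1 - c * (x - θ) ^ 2) ≤ 0 :=
        mul_nonpos_of_nonneg_of_nonpos hM.le (by linarith)
      exact h5.trans (hf.nonneg x)

theorem law_real_Icc_le {f : ℝ → ℝ} {a b B : ℝ} (hab : a ≤ b) (hB : 0 ≤ B)
    (h : ∀ y ∈ Icc a b, f y ≤ B) : (law f).real (Icc a b) ≤ B * (b - a) := by
  refine ENNReal.toReal_le_of_le_ofReal (mul_nonneg hB (sub_nonneg.2 hab)) ?_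
  rw [law, withDensity_apply _ measurableSet_Icc]
  calc ∫⁻ y in Icc a b, ENNReal.ofReal (f y) ≤ ∫⁻ _ in Icc a b, ENNReal.ofReal B :=
        setLIntegral_mono' measurableSet_Icc fun y hy => ENNReal.ofReal_le_ofReal (h y hy)
    _ = ENNReal.ofReal (B * (b - a)) := by
        rw [setLIntegral_const, Real.volume_Icc, ENNReal.ofReal_mul hB]

theorem le_law_real_Icc {f : ℝ → ℝ} [IsFiniteMeasure (law f)] {a b B : ℝ} (hB : 0 ≤ B)
    (h : ∀ y ∈ Icc a b, B ≤ f y) : B * (b - a) ≤ (law f).real (Icc a b) := by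
  refine (ENNReal.ofReal_le_iff_le_toReal (measure_ne_top _ _)).1 ?_
  rw [law, withDensity_apply _ measurableSet_Icc]
  calc ENNReal.ofReal (B * (b - a)) = ∫⁻ _ in Icc a b, ENNReal.ofReal B := by
        rw [setLIntegral_const, Real.volume_Icc, ENNReal.ofReal_mul hB]
    _ ≤ ∫⁻ y in Icc a b, ENNReal.ofReal (f y) :=
        setLIntegral_mono' measurableSet_Icc fun y hy => ENNReal.ofReal_le_ofReal (h y hy)

theorem IsModalDensity.law_compl_Icc {f : ℝ → ℝ} (hf : IsModalDensity f) :
    law f (Icc (0 : ℝ) 1)ᶜ = 0 := by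
  rw [law, withDensity_apply _ measurableSet_Icc.compl]
  refine (setLIntegral_congr_fun (g := fun _ => 0) measurableSet_Icc.compl fun y hy => ?_).trans
    (by simp)
  simp [hf.eq_zero_of_notMem y hy]

/-! ### Chernoff bounds for counts -/

/-- The number of sample points of `S` that lie in `A`, as a real number, so that it is a sum of
independent indicators for a random sample. -/
noncomputable def hits {m : ℕ} (S : Fin m → ℝ) (A : Set ℝ) : ℝ :=
  ∑ j, A.indicator (fun _ => (1 : ℝ)) (S j)

theorem exp_sub_one_le {l : ℝ} (h0 : -1 ≤ l) (h1 : l ≤ 1) : Real.exp l - 1 ≤ l + l ^ 2 := by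
  have := Real.abs_exp_sub_one_sub_id_le (abs_le.2 ⟨h0, h1⟩)
  linarith [(abs_le.1 this).2]

section Chernoff

variable {Ω : Type*} [MeasurableSpace Ω] {μ : Measure Ω} [IsProbabilityMeasure μ]
  {Y : ℕ → Ω → ℝ} {ν : Measure ℝ}

theorem measurable_hits (hY : ∀ s, Measurable (Y s)) {A : Set ℝ} (hA : MeasurableSet A) (m : ℕ) :
    Measurable fun ω => hits (fun s : Fin m => Y s ω) A :=
  Finset.measurable_sum _ fun s _ => (measurable_const.indicator hA).comp (hY s)

/-- The moment generating function of a number of hits is at most that of a Poisson variable with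
the same mean. -/
theorem mgf_hits_le (hY : ∀ s, Measurable (Y s)) (hν : ∀ s, μ.map (Y s) = ν)
    (hind : iIndepFun Y μ) {A : Set ℝ} (hA : MeasurableSet A) (m : ℕ) (l : ℝ) :
    mgf (fun ω => hits (fun s : Fin m => Y s ω) A) μ l ≤
      Real.exp (m * (ν.real A * (Real.exp l - 1))) := by
  have hone : Measurable (A.indicator (fun _ => (1 : ℝ))) := measurable_const.indicator hA
  have hind' : iIndepFun (fun s : Fin m => fun ω => A.indicator (fun _ => (1 : ℝ)) (Y s ω)) μ :=
    (hind.precomp Fin.val_injective).comp (fun _ => A.indicator (fun _ => (1 : ℝ)))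
      fun _ => hone
  have hsum : (fun ω => hits (fun s : Fin m => Y s ω) A) =
      ∑ s : Fin m, fun ω => A.indicator (fun _ => (1 : ℝ)) (Y s ω) := by
    ext ω; simp [hits]
  rw [hsum, hind'.mgf_sum (fun s => hone.comp (hY s))]
  have hfac : ∀ s : Fin m, mgf (fun ω => A.indicator (fun _ => (1 : ℝ)) (Y s ω)) μ l ≤
      Real.exp (ν.real A * (Real.exp l - 1)) := by
    intro s
    have hprob : IsProbabilityMeasure ν := hν s ▸ Measure.isProbabilityMeasure_map (hY s).aemeasurable
    have e1 : mgf (fun ω => A.indicator (fun _ => (1 : ℝ)) (Y s ω)) μ l =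
        ∫ x, Real.exp (l * A.indicator (fun _ => (1 : ℝ)) x) ∂ν := by
      rw [mgf, ← hν s, integral_map (hY s).aemeasurable]
      exact (Real.measurable_exp.comp (hone.const_mul l)).aestronglyMeasurable
    have e2 : (fun x => Real.exp (l * A.indicator (fun _ => (1 : ℝ)) x)) =
        fun x => 1 + A.indicator (fun _ => Real.exp l - 1) x := by
      ext x
      by_cases hx : x ∈ A <;> simp [hx]
    rw [e1, e2, integral_add (integrable_const _) ((integrable_const _).indicator hA),
      integral_indicator_const _ hA]
    simp only [integral_const, probReal_univ, smul_eq_mul, one_mul]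
    linarith [Real.add_one_le_exp (ν.real A * (Real.exp l - 1))]
  calc ∏ s : Fin m, mgf (fun ω => A.indicator (fun _ => (1 : ℝ)) (Y s ω)) μ l
      ≤ ∏ _s : Fin m, Real.exp (ν.real A * (Real.exp l - 1)) :=
        Finset.prod_le_prod (fun _ _ => mgf_nonneg) fun s _ => hfac s
    _ = _ := by
        rw [Finset.prod_const, Finset.card_univ, Fintype.card_fin, ← Real.exp_nat_mul]

theorem integrable_exp_hits (hY : ∀ s, Measurable (Y s)) {A : Set ℝ} (hA : MeasurableSet A)
    (m : ℕ) (l : ℝ) :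
    Integrable (fun ω => Real.exp (l * hits (fun s : Fin m => Y s ω) A)) μ := by
  refine Integrable.of_bound
    (Real.measurable_exp.comp ((measurable_hits hY hA m).const_mul l)).aestronglyMeasurable
    (Real.exp (|l| * m)) (Eventually.of_forall fun ω => ?_)
  rw [Real.norm_eq_abs, Real.abs_exp, Real.exp_le_exp]
  have h0 : 0 ≤ hits (fun s : Fin m => Y s ω) A :=
    Finset.sum_nonneg fun s _ => indicator_nonneg (fun _ _ => zero_le_one) _
  have h1 : hits (fun s : Fin m => Y s ω) A ≤ m := by
    calc hits (fun s : Fin m => Y s ω) A ≤ ∑ _s : Fin m, (1 : ℝ) :=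
          Finset.sum_le_sum fun s _ => indicator_le_self' (fun _ _ => zero_le_one) _
      _ = m := by simp
  calc l * _ ≤ |l| * hits (fun s : Fin m => Y s ω) A := by gcongr; exact le_abs_self l
    _ ≤ |l| * m := by gcongr

/-- Upper Chernoff bound, with the parameter `l` left free. -/
theorem measureReal_hits_ge_le (hY : ∀ s, Measurable (Y s)) (hν : ∀ s, μ.map (Y s) = ν)
    (hind : iIndepFun Y μ) {A : Set ℝ} (hA : MeasurableSet A) (m : ℕ) {P l : ℝ} (x : ℝ)
    (hP : ν.real A ≤ P) (hl0 : 0 ≤ l) (hl1 : l ≤ 1) :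
    μ.real {ω | m * P + x ≤ hits (fun s : Fin m => Y s ω) A} ≤
      Real.exp (m * P * l ^ 2 - l * x) := by
  refine (measure_ge_le_exp_mul_mgf _ hl0 (integrable_exp_hits hY hA m l)).trans ?_
  refine (mul_le_mul_of_nonneg_left (mgf_hits_le hY hν hind hA m l) (Real.exp_nonneg _)).trans ?_
  rw [← Real.exp_add, Real.exp_le_exp]
  have h1 := exp_sub_one_le (by linarith) hl1
  have h2 : ν.real A * (Real.exp l - 1) ≤ P * (l + l ^ 2) :=
    mul_le_mul hP h1 (by linarith [Real.add_one_le_exp l]) (measureReal_nonneg.trans hP)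
  have h3 := mul_le_mul_of_nonneg_left h2 (Nat.cast_nonneg (α := ℝ) m)
  nlinarith

/-- Lower Chernoff bound, with the parameter `l` left free. -/
theorem measureReal_hits_le_le (hY : ∀ s, Measurable (Y s)) (hν : ∀ s, μ.map (Y s) = ν)
    (hind : iIndepFun Y μ) {A : Set ℝ} (hA : MeasurableSet A) (m : ℕ) {P l : ℝ} (x : ℝ)
    (hP : P ≤ ν.real A) (hl0 : 0 ≤ l) (hl1 : l ≤ 1) :
    μ.real {ω | hits (fun s : Fin m => Y s ω) A ≤ m * P - x} ≤
      Real.exp (m * P * l ^ 2 - l * x) := by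
  refine (measure_le_le_exp_mul_mgf _ (neg_nonpos.2 hl0)
    (integrable_exp_hits hY hA m (-l))).trans ?_
  refine (mul_le_mul_of_nonneg_left (mgf_hits_le hY hν hind hA m (-l)) (Real.exp_nonneg _)).trans ?_
  rw [← Real.exp_add, Real.exp_le_exp]
  have h1 := exp_sub_one_le (l := -l) (by linarith) (by linarith)
  have h0 : -l + l ^ 2 ≤ 0 := by nlinarith
  have h2 : ν.real A * (Real.exp (-l) - 1) ≤ P * (-l + l ^ 2) :=
    calc ν.real A * (Real.exp (-l) - 1) ≤ ν.real A * (-l + l ^ 2) := by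
          refine mul_le_mul_of_nonneg_left ?_ measureReal_nonneg
          simpa using h1
      _ ≤ P * (-l + l ^ 2) := mul_le_mul_of_nonpos_right hP h0
  have h3 := mul_le_mul_of_nonneg_left h2 (Nat.cast_nonneg (α := ℝ) m)
  nlinarith

end Chernoff

/-! ### Nearest-neighbour radii and the two-level grid -/

section Hits

variable {m : ℕ} {S : Fin m → ℝ}

theorem hits_mono {A B : Set ℝ} (h : A ⊆ B) : hits S A ≤ hits S B :=
  Finset.sum_le_sum fun _ _ => indicator_le_indicator_of_subset h (fun _ => zero_le_one) _

theorem hits_union_le (A B : Set ℝ) : hits S (A ∪ B) ≤ hits S A + hits S B := by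
  rw [hits, hits, hits, ← Finset.sum_add_distrib]
  refine Finset.sum_le_sum fun j _ => ?_
  by_cases hA : S j ∈ A <;> by_cases hB : S j ∈ B <;> simp [hA, hB]

theorem card_filter_eq_hits (y r : ℝ) :
    ((Finset.univ.filter fun j => |S j - y| ≤ r).card : ℝ) = hits S (Icc (y - r) (y + r)) := by
  rw [hits, Finset.card_filter, Nat.cast_sum]
  refine Finset.sum_congr rfl fun j _ => ?_
  have : |S j - y| ≤ r ↔ S j ∈ Icc (y - r) (y + r) := by
    rw [mem_Icc, abs_le]; constructor <;> rintro ⟨h1, h2⟩ <;> constructor <;> linarith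
  by_cases h : |S j - y| ≤ r
  · simp [h, indicator_of_mem (this.1 h)]
  · simp [h, indicator_of_notMem (fun h' => h (this.2 h'))]

theorem exists_mem_of_hits_pos {A : Set ℝ} (h : 0 < hits S A) : ∃ j, S j ∈ A := by
  by_contra! hne
  exact h.ne' (Finset.sum_eq_zero fun j _ => indicator_of_notMem (hne j) _)

theorem knnRadius_le {k y r : ℝ} (hk : 0 < k) (h : k ≤ hits S (Icc (y - r) (y + r))) :
    knnRadius S k y ≤ r := by
  refine csInf_le ⟨0, fun t ht => ?_⟩ (by simpa [card_filter_eq_hits] using h)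
  have ht' : k ≤ hits S (Icc (y - t) (y + t)) := by
    rw [← card_filter_eq_hits]; exact ht
  obtain ⟨j, hj⟩ := exists_mem_of_hits_pos (hk.trans_le ht')
  linarith [hj.1, hj.2]

theorem le_knnRadius {k y r : ℝ} (hk : k ≤ m) (h : hits S (Icc (y - r) (y + r)) < k) :
    r ≤ knnRadius S k y := by
  refine le_csInf ⟨∑ j, |S j - y|, ?_⟩ fun t ht => ?_
  · have : (Finset.univ.filter fun j => |S j - y| ≤ ∑ j, |S j - y|) = Finset.univ :=
      Finset.filter_true_of_mem fun j _ =>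
        Finset.single_le_sum (f := fun j => |S j - y|) (fun _ _ => abs_nonneg _)
          (Finset.mem_univ j)
    simpa [this] using hk
  · have ht' : k ≤ hits S (Icc (y - t) (y + t)) := by
      rw [← card_filter_eq_hits]; exact ht
    by_contra! hlt
    exact absurd (ht'.trans (hits_mono (Icc_subset_Icc (by linarith) (by linarith)))) (not_le.2 h)

/-- If some sample point lies within `s` of `θ`, the ball of radius `r - s` about `θ` already holds
`k` points, and the larger balls about all sample points farther than `ε` from `θ` hold fewer than
`k` points, then every sample mode is within `ε` of `θ`. -/
theorem IsSampleMode.abs_sub_le {θ ε s r R z : ℝ} (hm : 0 < m) (hrR : r < R)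
    (hnear : 0 < hits S (Icc (θ - s) (θ + s)))
    (hgood : (m : ℝ) ^ (4 / 5 : ℝ) ≤ hits S (Icc (θ - (r - s)) (θ + (r - s))))
    (hbad : ∀ j, ε < |S j - θ| → hits S (Icc (S j - R) (S j + R)) < (m : ℝ) ^ (4 / 5 : ℝ))
    (hz : IsSampleMode S z) : |z - θ| ≤ ε := by
  obtain ⟨j, rfl, hj⟩ := hz
  obtain ⟨l, hl⟩ := exists_mem_of_hits_pos hnear
  by_contra! hlt
  have hm1 : (1 : ℝ) ≤ m := by exact_mod_cast hm
  have hk : (m : ℝ) ^ (4 / 5 : ℝ) ≤ m := by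
    simpa using Real.rpow_le_rpow_of_exponent_le hm1 (show (4 / 5 : ℝ) ≤ 1 by norm_num)
  have h1 := le_knnRadius hk (hbad j hlt)
  have h2 : knnRadius S ((m : ℝ) ^ (4 / 5 : ℝ)) (S l) ≤ r := by
    refine knnRadius_le (by positivity) (hgood.trans (hits_mono (Icc_subset_Icc ?_ ?_)))
    · linarith [hl.2]
    · linarith [hl.1]
  linarith [hj l]

/-- An interval of radius `R` is covered by an interval of length `2 * R - ρ` that starts at a point
`θ + j * ρ` of the coarse grid, together with two edges inside cells of length `ρ`, whose lengths
are multiples of the fine mesh `ρ / m` and add up to little more than `ρ`. -/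
theorem exists_grid_cover (hm : 0 < m) {ρ : ℝ} (hρ : 0 < ρ) (θ x R : ℝ) :
    ∃ (j : ℤ) (i₁ i₂ : ℕ), i₁ ≤ m ∧ i₂ ≤ m ∧ (i₁ + i₂ : ℝ) * (ρ / m) ≤ ρ + 2 * (ρ / m) ∧
      x - R ≤ θ + j * ρ ∧ θ + j * ρ < x - R + ρ ∧
      hits S (Icc (x - R) (x + R)) ≤
        hits S (Icc (θ + j * ρ - i₁ * (ρ / m)) (θ + j * ρ)) +
        hits S (Icc (θ + j * ρ) (θ + j * ρ + (2 * R - ρ))) +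
        hits S (Icc (θ + j * ρ + (2 * R - ρ)) (θ + j * ρ + (2 * R - ρ) + i₂ * (ρ / m))) := by
  have hm' : (0 : ℝ) < m := by exact_mod_cast hm
  have hσ : 0 < ρ / m := by positivity
  have hmσ : (m : ℝ) * (ρ / m) = ρ := by field_simp
  set j := ⌈(x - R - θ) / ρ⌉
  have hj1 : x - R - θ ≤ j * ρ := (div_le_iff₀ hρ).1 (Int.le_ceil _)
  have hj2 : j * ρ < x - R - θ + ρ := by
    have := Int.ceil_lt_add_one ((x - R - θ) / ρ)
    rw [← sub_lt_iff_lt_add, lt_div_iff₀ hρ] at this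
    linarith
  set p := θ + j * ρ
  set σ := ρ / m
  have hedge : ∀ t, 0 ≤ t → t ≤ ρ → ⌈t / σ⌉₊ ≤ m ∧ t ≤ ⌈t / σ⌉₊ * σ ∧ ⌈t / σ⌉₊ * σ ≤ t + σ := by
    intro t h0 h1
    refine ⟨Nat.ceil_le.2 ((div_le_iff₀ hσ).2 (by linarith)), (div_le_iff₀ hσ).1 (Nat.le_ceil _),
      ?_⟩
    have := (Nat.ceil_lt_add_one (div_nonneg h0 hσ.le)).le
    rw [← sub_le_iff_le_add, le_div_iff₀ hσ] at this
    linarith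
  obtain ⟨a1, a2, a3⟩ := hedge (p - (x - R)) (by linarith) (by linarith)
  obtain ⟨b1, b2, b3⟩ := hedge (ρ - (p - (x - R))) (by linarith) (by linarith)
  refine ⟨j, _, _, a1, b1, by linarith, by linarith, by linarith, ?_⟩
  refine (hits_mono ?_).trans ((hits_union_le _ _).trans (add_le_add_left (hits_union_le _ _) _))
  intro y hy
  rcases le_or_gt y p with h | h
  · exact Or.inl (Or.inl ⟨by linarith [hy.1], h⟩)
  · rcases le_or_gt y (p + (2 * R - ρ)) with h' | h'
    · exact Or.inl (Or.inr ⟨h.le, h'⟩)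
    · exact Or.inr ⟨h'.le, by linarith [hy.2]⟩

end Hits

/-! ### The regime of sample sizes and accuracies -/

/-- The regime in which the concentration estimates hold. Here `M` is the maximum of the density,
`β` and `c` are its quadratic constants at the mode, `m = g ^ 5` is the sample size with logarithm
`ℓ`, so that the `k`-nearest-neighbour balls have `k = g ^ 4` and mass about `1 / g`, and `ε` is the
accuracy, so that `ε * g` is the accuracy in units of that mass. For a fixed density, all conditions
hold as soon as `g` and `ε * g` are large. -/
structure Regime (M β c g ε ℓ : ℝ) (m : ℕ) : Prop where
  M_pos : 0 < M
  β_pos : 0 < β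
  β_le : β ≤ 1 / 16
  c_pos : 0 < c
  one_le_g : 1 ≤ g
  ε_pos : 0 < ε
  ε_le : ε ≤ 1
  m_eq : (m : ℝ) = g ^ 5
  exp_ℓ : Real.exp ℓ = m
  one_le_ℓ : 1 ≤ ℓ
  M_le_ℓ : 12 * M ≤ ℓ
  ℓ_le : 2 * ℓ ≤ g ^ 4
  M_le_g : 64 * M ≤ β * g ^ 3
  β_g : 1024 ≤ β * g ^ 2
  ℓ_le_g : 512 / β * (ℓ + 1) ≤ g ^ 2
  one_le_T : 1 ≤ ε * g
  M_T : 24 ≤ M * (ε * g)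
  c_T : 64 * c ≤ M ^ 2 * β * (ε * g) ^ 2
  M_le_T : 256 * M * (512 / β) ≤ β * (ε * g) ^ 2

/-- Radius of the balls about sample points far from the mode. -/
noncomputable def outerRadius (M β g ε : ℝ) : ℝ := (1 + β * ε ^ 2 / 4) / (2 * M * g)

/-- Radius of the ball about the sample point that competes with the points far from the mode. -/
noncomputable def innerRadius (M β g ε : ℝ) : ℝ := (1 + β * ε ^ 2 / 8) / (2 * M * g)

/-- Distance from the mode within which a sample point is sought. -/
noncomputable def nearRadius (M β g ε : ℝ) : ℝ := β * ε ^ 2 / (64 * M * g)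

/-- Mesh of the coarse grid: smaller by the factor `ℓ` than a nearest-neighbour ball, which gains
a factor `ℓ` in the exponent for the events that live inside one cell. -/
noncomputable def coarseMesh (g ℓ : ℝ) : ℝ := 1 / (g * ℓ)

/-- Upper bound for the mass of an interval of length `2 * outerRadius - coarseMesh` at distance `w`
from the mode. -/
noncomputable def farMass (M β g ε ℓ w : ℝ) : ℝ :=
  M * (1 - 3 / 4 * β * w ^ 2) * (2 * outerRadius M β g ε - coarseMesh g ℓ)

/-- The coarse grid points, given by their index, at which an interval about a sample point farther
than `ε` from the mode can start. -/
noncomputable def farIndices (g ε ℓ : ℝ) (m : ℕ) : Finset ℤ :=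
  (Finset.Icc (-m : ℤ) m).filter fun j =>
    3 / 4 * ε ≤ |(j : ℝ)| * coarseMesh g ℓ ∧ |(j : ℝ)| * coarseMesh g ℓ ≤ 2

namespace Regime

variable {M β c g ε ℓ : ℝ} {m : ℕ}

theorem g_pos (h : Regime M β c g ε ℓ m) : 0 < g := one_pos.trans_le h.one_le_g

theorem ℓ_pos (h : Regime M β c g ε ℓ m) : 0 < ℓ := one_pos.trans_le h.one_le_ℓ

theorem m_pos (h : Regime M β c g ε ℓ m) : (0 : ℝ) < m := by
  rw [h.m_eq]; exact pow_pos h.g_pos 5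

theorem coarseMesh_pos (h : Regime M β c g ε ℓ m) : 0 < coarseMesh g ℓ :=
  one_div_pos.2 (mul_pos h.g_pos h.ℓ_pos)

theorem βε_le (h : Regime M β c g ε ℓ m) : β * ε ^ 2 ≤ 1 / 16 := by
  have h1 := h.β_le; have h2 := h.ε_le; have h3 := h.ε_pos; have h4 := h.β_pos
  nlinarith [mul_le_one₀ h2 h3.le h2]

theorem βε_pos (h : Regime M β c g ε ℓ m) : 0 < β * ε ^ 2 :=
  mul_pos h.β_pos (pow_pos h.ε_pos 2)

theorem outerRadius_le (h : Regime M β c g ε ℓ m) :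
    outerRadius M β g ε ≤ 3 / (5 * M * g) := by
  have := h.βε_le; have hM := h.M_pos; have hg := h.g_pos
  rw [outerRadius, div_le_div_iff₀ (by positivity) (by positivity)]
  have : 0 < M * g := by positivity
  nlinarith

theorem inv_Mg_le (h : Regime M β c g ε ℓ m) : 1 / (M * g) ≤ ε / 24 := by
  have hM := h.M_pos; have hg := h.g_pos
  rw [div_le_div_iff₀ (by positivity) (by positivity)]
  linarith [h.M_T]

theorem coarseMesh_le (h : Regime M β c g ε ℓ m) : coarseMesh g ℓ ≤ 1 / (12 * (M * g)) := by
  have hM := h.M_pos; have hg := h.g_pos; have hl := h.ℓ_pos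
  rw [coarseMesh, div_le_div_iff₀ (by positivity) (by positivity)]
  nlinarith [h.M_le_ℓ]

theorem inner_lt_outer (h : Regime M β c g ε ℓ m) :
    innerRadius M β g ε < outerRadius M β g ε := by
  have := h.βε_pos; have hM := h.M_pos; have hg := h.g_pos
  rw [innerRadius, outerRadius]
  gcongr
  linarith

theorem outerRadius_le_ε (h : Regime M β c g ε ℓ m) : outerRadius M β g ε ≤ ε / 40 := by
  have h1 := h.outerRadius_le
  have h2 := h.inv_Mg_le
  have : 3 / (5 * M * g) = 3 / 5 * (1 / (M * g)) := by
    have hM := h.M_pos; have hg := h.g_pos; field_simp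
  linarith

theorem one_le_two_mul_outerRadius (h : Regime M β c g ε ℓ m) :
    1 / (2 * (M * g)) ≤ outerRadius M β g ε := by
  have := h.βε_pos; have hM := h.M_pos; have hg := h.g_pos
  rw [outerRadius, mul_assoc]
  gcongr
  linarith

theorem length_nonneg (h : Regime M β c g ε ℓ m) :
    0 ≤ 2 * outerRadius M β g ε - coarseMesh g ℓ := by
  have h1 := h.coarseMesh_le
  have h2 := h.one_le_two_mul_outerRadius
  have hM := h.M_pos; have hg := h.g_pos
  have e1 : 1 / (12 * (M * g)) = 1 / 12 * (1 / (M * g)) := by field_simp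
  have e2 : 1 / (2 * (M * g)) = 1 / 2 * (1 / (M * g)) := by field_simp
  have : 0 < 1 / (M * g) := by positivity
  linarith

/-- Outside the exceptional events of the two-level grid, the ball of radius `outerRadius` about a
point whose distance to the mode lies between `ε` and `1` holds fewer than `k = g ^ 4` sample points. -/
theorem hits_outer_lt (h : Regime M β c g ε ℓ m) {S : Fin m → ℝ} {θ x : ℝ}
    (hx1 : |x - θ| ≤ 1) (hxε : ε < |x - θ|)
    (hcoarse : ∀ j ∈ farIndices g ε ℓ m,
      hits S (Icc (θ + j * coarseMesh g ℓ)
        (θ + j * coarseMesh g ℓ + (2 * outerRadius M β g ε - coarseMesh g ℓ))) <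
      m * farMass M β g ε ℓ (|(j : ℝ)| * coarseMesh g ℓ) +
        g ^ 4 * (β * (|(j : ℝ)| * coarseMesh g ℓ) ^ 2 / 16))
    (hleft : ∀ j ∈ farIndices g ε ℓ m, ∀ i ∈ Finset.range (m + 1),
      hits S (Icc (θ + j * coarseMesh g ℓ - i * (coarseMesh g ℓ / m)) (θ + j * coarseMesh g ℓ)) <
      m * (M * (i * (coarseMesh g ℓ / m))) + g ^ 4 * (β * ε ^ 2 / 64))
    (hright : ∀ j ∈ farIndices g ε ℓ m, ∀ i ∈ Finset.range (m + 1),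
      hits S (Icc (θ + j * coarseMesh g ℓ + (2 * outerRadius M β g ε - coarseMesh g ℓ))
        (θ + j * coarseMesh g ℓ + (2 * outerRadius M β g ε - coarseMesh g ℓ) +
          i * (coarseMesh g ℓ / m))) <
      m * (M * (i * (coarseMesh g ℓ / m))) + g ^ 4 * (β * ε ^ 2 / 64)) :
    hits S (Icc (x - outerRadius M β g ε) (x + outerRadius M β g ε)) < g ^ 4 := by
  have hM := h.M_pos; have hg := h.g_pos; have hl := h.ℓ_pos; have hmp := h.m_pos
  have hβ := h.β_pos; have hε := h.ε_pos
  set ρ := coarseMesh g ℓ with hρ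
  set R := outerRadius M β g ε with hR
  have hρ0 : 0 < ρ := h.coarseMesh_pos
  obtain ⟨j, i₁, i₂, hi₁, hi₂, hsum, hj1, hj2, hcov⟩ :=
    exists_grid_cover (S := S) (by exact_mod_cast hmp) hρ0 θ x R
  have hRε : R ≤ ε / 40 := h.outerRadius_le_ε
  have hρR : ρ ≤ R := by
    have h1 := h.coarseMesh_le
    have h2 := h.one_le_two_mul_outerRadius
    have e1 : 1 / (12 * (M * g)) = 1 / 12 * (1 / (M * g)) := by field_simp
    have e2 : 1 / (2 * (M * g)) = 1 / 2 * (1 / (M * g)) := by field_simp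
    have : 0 < 1 / (M * g) := by positivity
    linarith
  have hR0 : 0 < R := hρ0.trans_le hρR
  set w := |(j : ℝ)| * ρ with hw
  have hw' : w = |j * ρ| := by rw [hw, abs_mul, abs_of_pos hρ0]
  have hclose : |j * ρ - (x - θ)| ≤ R := abs_le.2 ⟨by linarith, by linarith⟩
  have hw1 : 3 / 4 * ε ≤ w := by
    have := abs_sub_abs_le_abs_sub (x - θ) (j * ρ)
    rw [abs_sub_comm (x - θ)] at this
    linarith
  have hw2 : w ≤ 2 := by
    have := abs_sub_abs_le_abs_sub (j * ρ) (x - θ)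
    linarith [h.ε_le]
  have hjm : |(j : ℝ)| ≤ m := by
    have h1 : |(j : ℝ)| ≤ 2 * (g * ℓ) := by
      have : |(j : ℝ)| * (1 / (g * ℓ)) ≤ 2 := hw2
      rwa [mul_one_div, div_le_iff₀ (by positivity)] at this
    have h2 : 2 * (g * ℓ) ≤ g ^ 5 := by nlinarith [h.ℓ_le]
    rw [h.m_eq]; linarith
  have hjmem : j ∈ farIndices g ε ℓ m := by
    rw [farIndices, Finset.mem_filter, Finset.mem_Icc]
    rw [abs_le] at hjm
    exact ⟨⟨by exact_mod_cast hjm.1, by exact_mod_cast hjm.2⟩, hw1, hw2⟩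
  have c1 := hcoarse j hjmem
  have c2 := hleft j hjmem i₁ (Finset.mem_range.2 (by omega))
  have c3 := hright j hjmem i₂ (Finset.mem_range.2 (by omega))
  refine hcov.trans_lt ?_
  have hk : 0 < g ^ 4 := by positivity
  have hmk : (m : ℝ) = g ^ 4 * g := by rw [h.m_eq]; ring
  -- all terms in units of `g ^ 4`
  set A := M * g * ρ with hA
  have hA12 : A ≤ 1 / 12 := by
    have h1 := mul_le_mul_of_nonneg_left h.coarseMesh_le (by positivity : 0 ≤ M * g)
    have h2 : M * g * (1 / (12 * (M * g))) = 1 / 12 := by field_simp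
    linarith
  set B := M * g * (ρ / m) with hB
  have hB64 : B ≤ β * ε ^ 2 / 64 := by
    have hBe : B = M / (ℓ * g ^ 5) := by
      rw [hB, hρ, coarseMesh, h.m_eq]; field_simp
    rw [hBe, div_le_div_iff₀ (by positivity) (by norm_num)]
    have hT : 1 ≤ (ε * g) ^ 2 := one_le_pow₀ h.one_le_T
    calc M * 64 ≤ β * g ^ 3 := by linarith [h.M_le_g]
      _ = β * g ^ 3 * 1 * 1 := by ring
      _ ≤ β * g ^ 3 * (ε * g) ^ 2 * ℓ := by gcongr; exact h.one_le_ℓ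
      _ = β * ε ^ 2 * (ℓ * g ^ 5) := by ring
  have hRe : 2 * (M * g * R) = 1 + β * ε ^ 2 / 4 := by
    rw [hR, outerRadius]; field_simp
  have hfar : m * farMass M β g ε ℓ w =
      g ^ 4 * ((1 - 3 / 4 * β * w ^ 2) * (1 + β * ε ^ 2 / 4 - A)) := by
    rw [farMass, hmk, ← hR, ← hρ, ← hRe, hA]; ring
  rw [← hw, hfar] at c1
  have hedges : m * (M * (i₁ * (ρ / m))) + m * (M * (i₂ * (ρ / m))) ≤ g ^ 4 * (A + 2 * B) := by
    have : m * (M * (i₁ * (ρ / m))) + m * (M * (i₂ * (ρ / m))) =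
      g ^ 4 * ((M * g) * ((i₁ + i₂ : ℝ) * (ρ / m))) := by rw [hmk]; ring
    rw [this]
    have e : A + 2 * B = (M * g) * (ρ + 2 * (ρ / m)) := by rw [hA, hB]; ring
    rw [e]
    gcongr
  have hmain : (A + 2 * B) + β * ε ^ 2 / 64 + β * ε ^ 2 / 64 +
      (1 - 3 / 4 * β * w ^ 2) * (1 + β * ε ^ 2 / 4 - A) + β * w ^ 2 / 16 ≤ 1 := by
    have h1 : 3 / 4 * β * w ^ 2 * (11 / 12) ≤ 3 / 4 * β * w ^ 2 * (1 + β * ε ^ 2 / 4 - A) := by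
      gcongr
      linarith [h.βε_pos]
    have h2 : 9 / 16 * ε ^ 2 ≤ w ^ 2 := by nlinarith
    have h3 := mul_le_mul_of_nonneg_left h2 hβ.le
    have h4 : (1 - 3 / 4 * β * w ^ 2) * (1 + β * ε ^ 2 / 4 - A) =
        (1 + β * ε ^ 2 / 4 - A) - 3 / 4 * β * w ^ 2 * (1 + β * ε ^ 2 / 4 - A) := by ring
    rw [h4]
    linarith [h.βε_pos]
  have := mul_le_mul_of_nonneg_left hmain hk.le
  linarith

end Regime

/-! ### Concentration of the counts -/

namespace Regime

variable {M β c g ε ℓ : ℝ} {m : ℕ}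

theorem m_mul_outerRadius (h : Regime M β c g ε ℓ m) :
    m * (M * (2 * outerRadius M β g ε)) = g ^ 4 * (1 + β * ε ^ 2 / 4) := by
  have hM := h.M_pos; have hg := h.g_pos
  rw [h.m_eq, outerRadius]
  field_simp

section Probability

variable {f : ℝ → ℝ} {θ : ℝ} {Ω : Type*} [MeasurableSpace Ω] {μ : Measure Ω}
  [IsProbabilityMeasure μ] {Y : ℕ → Ω → ℝ}

theorem measureReal_coarse_le (h : Regime (f θ) β c g ε ℓ m)
    (hup : ∀ x, |x - θ| ≤ 4 → f x ≤ f θ * (1 - β * (x - θ) ^ 2))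
    (hY : ∀ s, Measurable (Y s)) (hlaw : ∀ s, μ.map (Y s) = law f) (hind : iIndepFun Y μ)
    {j : ℤ} (hj : j ∈ farIndices g ε ℓ m) :
    μ.real {ω | m * farMass (f θ) β g ε ℓ (|(j : ℝ)| * coarseMesh g ℓ) +
        g ^ 4 * (β * (|(j : ℝ)| * coarseMesh g ℓ) ^ 2 / 16) ≤
      hits (fun s : Fin m => Y s ω) (Icc (θ + j * coarseMesh g ℓ)
        (θ + j * coarseMesh g ℓ + (2 * outerRadius (f θ) β g ε - coarseMesh g ℓ)))} ≤
    Real.exp (-(β ^ 2 / 2048 * g ^ 4 * (|(j : ℝ)| * coarseMesh g ℓ) ^ 4)) := by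
  have hM := h.M_pos; have hg := h.g_pos; have hβ := h.β_pos; have hε := h.ε_pos
  have hρ0 := h.coarseMesh_pos
  have hRε := h.outerRadius_le_ε
  have hlen := h.length_nonneg
  have hβ1 := h.β_le
  have hmR := h.m_mul_outerRadius
  have hβε := h.βε_le
  obtain ⟨-, hw1, hw2⟩ := Finset.mem_filter.1 hj
  have hw' : |(j : ℝ)| * coarseMesh g ℓ = |j * coarseMesh g ℓ| := by
    rw [abs_mul, abs_of_pos hρ0]
  have hmass : farMass (f θ) β g ε ℓ (|(j : ℝ)| * coarseMesh g ℓ) =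
    f θ * (1 - 3 / 4 * β * (|(j : ℝ)| * coarseMesh g ℓ) ^ 2) *
      (2 * outerRadius (f θ) β g ε - coarseMesh g ℓ) := rfl
  set w := |(j : ℝ)| * coarseMesh g ℓ
  set R := outerRadius (f θ) β g ε
  set ρ := coarseMesh g ℓ
  have hw0 : 0 ≤ w := by linarith
  have hw4 : w ^ 2 ≤ 4 := by nlinarith
  have hβw : β * w ^ 2 ≤ 1 / 4 := by nlinarith
  have hβw0 : 0 ≤ β * w ^ 2 := by positivity
  have hB : 0 ≤ f θ * (1 - 3 / 4 * β * w ^ 2) := mul_nonneg hM.le (by linarith)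
  have hle : (law f).real (Icc (θ + j * ρ) (θ + j * ρ + (2 * R - ρ))) ≤
      farMass (f θ) β g ε ℓ w := by
    refine (law_real_Icc_le (by linarith) hB fun y hy => ?_).trans_eq ?_
    · have hd : |j * ρ - (y - θ)| ≤ w / 15 :=
        abs_le.2 ⟨by linarith [hy.2], by linarith [hy.1]⟩
      have h1 : w - w / 15 ≤ |y - θ| := by
        have := abs_sub_abs_le_abs_sub (j * ρ) (y - θ)
        linarith
      have h2 : |y - θ| ≤ 4 := by
        have := abs_sub_abs_le_abs_sub (y - θ) (j * ρ)
        rw [abs_sub_comm (y - θ)] at this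
        linarith [h.ε_le]
      refine (hup y h2).trans ?_
      have h3 : 3 / 4 * w ^ 2 ≤ (y - θ) ^ 2 := by
        rw [← sq_abs (y - θ)]; nlinarith
      have h4 := mul_le_mul_of_nonneg_left h3 hβ.le
      gcongr f θ * ?_
      linarith
    · rw [hmass]; ring
  have hmP : m * farMass (f θ) β g ε ℓ w ≤ 2 * g ^ 4 := by
    have h1 : farMass (f θ) β g ε ℓ w ≤ f θ * (2 * R) := by
      rw [hmass, mul_assoc]
      gcongr f θ * ?_
      nlinarith
    have h2 := mul_le_mul_of_nonneg_left h1 h.m_pos.le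
    have : 0 < g ^ 4 := by positivity
    nlinarith
  -- minimizer of the exponent
  have hl1 : β * w ^ 2 / 64 ≤ 1 := by linarith
  refine (measureReal_hits_ge_le hY hlaw hind measurableSet_Icc m _ hle
    (by positivity : 0 ≤ β * w ^ 2 / 64) hl1).trans ?_
  rw [Real.exp_le_exp]
  have := mul_le_mul_of_nonneg_right hmP (sq_nonneg (β * w ^ 2 / 64))
  nlinarith

theorem measureReal_edge_le (h : Regime (f θ) β c g ε ℓ m) (hθ : IsMode f θ)
    (hY : ∀ s, Measurable (Y s)) (hlaw : ∀ s, μ.map (Y s) = law f) (hind : iIndepFun Y μ)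
    (a : ℝ) {i : ℕ} (hi : i ≤ m) :
    μ.real {ω | m * (f θ * (i * (coarseMesh g ℓ / m))) + g ^ 4 * (β * ε ^ 2 / 64) ≤
      hits (fun s : Fin m => Y s ω) (Icc a (a + i * (coarseMesh g ℓ / m)))} ≤
    Real.exp (-(4 * ℓ + 4 * (ε * g) ^ 2)) := by
  have hM := h.M_pos; have hg := h.g_pos; have hβ := h.β_pos; have hε := h.ε_pos
  have hρ0 := h.coarseMesh_pos; have hl := h.ℓ_pos; have hm := h.m_pos
  have hT : 1 ≤ (ε * g) ^ 2 := one_le_pow₀ h.one_le_T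
  have hle : (law f).real (Icc a (a + i * (coarseMesh g ℓ / m))) ≤
      f θ * (i * (coarseMesh g ℓ / m)) := by
    refine (law_real_Icc_le (by linarith [show 0 ≤ i * (coarseMesh g ℓ / m) by positivity])
      hM.le fun y _ => hθ y).trans_eq ?_
    rw [add_sub_cancel_left]
  -- the variance factor is at most `g ^ 4 * f θ / ℓ`, the mass of one coarse cell
  have hvar : m * (f θ * (i * (coarseMesh g ℓ / m))) ≤ g ^ 4 * f θ / ℓ := by
    have hi' : (i : ℝ) ≤ m := by exact_mod_cast hi
    calc m * (f θ * (i * (coarseMesh g ℓ / m))) ≤ m * (f θ * (m * (coarseMesh g ℓ / m))) := by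
          gcongr
      _ = m * f θ * coarseMesh g ℓ := by field_simp
      _ = g ^ 4 * f θ / ℓ := by rw [h.m_eq, coarseMesh]; field_simp
  -- With this parameter the exponent is `-4 * (ℓ + (ε * g) ^ 2)` exactly when the quadratic term is
  -- half of the linear one; `hl2` says that it is at most that, because a cell has mass `f θ / (g * ℓ)`.
  set l := 512 / β * (ℓ + (ε * g) ^ 2) / (g ^ 4 * ε ^ 2) with hl_def
  have hl0 : 0 ≤ l := by positivity
  have hl1 : l ≤ 1 := by
    rw [hl_def, div_le_one (by positivity)]
    calc 512 / β * (ℓ + (ε * g) ^ 2) ≤ 512 / β * (ℓ * (ε * g) ^ 2 + (ε * g) ^ 2) := by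
          gcongr; exact le_mul_of_one_le_right hl.le hT
      _ = 512 / β * (ℓ + 1) * (ε * g) ^ 2 := by ring
      _ ≤ g ^ 2 * (ε * g) ^ 2 := by gcongr; exact h.ℓ_le_g
      _ = g ^ 4 * ε ^ 2 := by ring
  have hl2 : f θ * l / ℓ ≤ β * ε ^ 2 / 128 := by
    have hsum : ℓ + (ε * g) ^ 2 ≤ 2 * (ℓ * (ε * g) ^ 2) := by
      have h1 : ℓ ≤ ℓ * (ε * g) ^ 2 := le_mul_of_one_le_right hl.le hT
      have h2 : (ε * g) ^ 2 ≤ ℓ * (ε * g) ^ 2 := le_mul_of_one_le_left (by positivity) h.one_le_ℓ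
      linarith
    rw [div_le_div_iff₀ hl (by norm_num), hl_def, mul_div_assoc', div_mul_eq_mul_div,
      div_le_iff₀ (by positivity)]
    calc f θ * (512 / β * (ℓ + (ε * g) ^ 2)) * 128
        ≤ f θ * (512 / β * (2 * (ℓ * (ε * g) ^ 2))) * 128 := by gcongr
      _ = 256 * f θ * (512 / β) * (ℓ * (ε * g) ^ 2) := by ring
      _ ≤ β * (ε * g) ^ 2 * (ℓ * (ε * g) ^ 2) := mul_le_mul_of_nonneg_right h.M_le_T (by positivity)
      _ = β * ε ^ 2 * ℓ * (g ^ 4 * ε ^ 2) := by ring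
  refine (measureReal_hits_ge_le hY hlaw hind measurableSet_Icc m _ hle hl0 hl1).trans ?_
  rw [Real.exp_le_exp]
  calc m * (f θ * (i * (coarseMesh g ℓ / m))) * l ^ 2 - l * (g ^ 4 * (β * ε ^ 2 / 64))
      ≤ g ^ 4 * f θ / ℓ * l ^ 2 - l * (g ^ 4 * (β * ε ^ 2 / 64)) := by gcongr
    _ = g ^ 4 * l * (f θ * l / ℓ) - l * (g ^ 4 * (β * ε ^ 2 / 64)) := by ring
    _ ≤ g ^ 4 * l * (β * ε ^ 2 / 128) - l * (g ^ 4 * (β * ε ^ 2 / 64)) := by gcongr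
    _ = -(4 * ℓ + 4 * (ε * g) ^ 2) := by rw [hl_def]; field_simp; ring

theorem c_mul_sq_le (h : Regime M β c g ε ℓ m) {t : ℝ} (ht0 : 0 ≤ t) (ht : t ≤ 1 / (M * g)) :
    c * t ^ 2 ≤ β * ε ^ 2 / 64 := by
  have hM := h.M_pos; have hg := h.g_pos; have hc := h.c_pos
  calc c * t ^ 2 ≤ c * (1 / (M * g)) ^ 2 := by gcongr
    _ ≤ β * ε ^ 2 / 64 := by
      rw [one_div, inv_pow, ← div_eq_mul_inv, div_le_div_iff₀ (by positivity) (by norm_num)]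
      linarith [h.c_T, show M ^ 2 * β * (ε * g) ^ 2 = β * ε ^ 2 * (M * g) ^ 2 by ring]

/-- Lower bound for the mass of a short interval centred at the mode. -/
theorem le_law_real_of_le (h : Regime (f θ) β c g ε ℓ m) [IsFiniteMeasure (law f)]
    (hlo : ∀ x, f θ * (1 - c * (x - θ) ^ 2) ≤ f x) {t : ℝ} (ht0 : 0 ≤ t)
    (ht : t ≤ 1 / (f θ * g)) :
    f θ * (1 - β * ε ^ 2 / 64) * (2 * t) ≤ (law f).real (Icc (θ - t) (θ + t)) := by
  have hM := h.M_pos; have hc := h.c_pos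
  have hβε := h.βε_le
  refine le_trans (le_of_eq (by ring)) (le_law_real_Icc
    (mul_nonneg hM.le (by linarith : 0 ≤ 1 - β * ε ^ 2 / 64)) fun y hy => le_trans ?_ (hlo y))
  have h1 : (y - θ) ^ 2 ≤ t ^ 2 := sq_le_sq' (by linarith [hy.1]) (by linarith [hy.2])
  have h2 := h.c_mul_sq_le ht0 ht
  have h3 := mul_le_mul_of_nonneg_left h1 hc.le
  gcongr f θ * ?_
  linarith

theorem nearRadius_pos (h : Regime M β c g ε ℓ m) : 0 < nearRadius M β g ε := by
  have hM := h.M_pos; have hg := h.g_pos; have := h.βε_pos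
  rw [nearRadius]; positivity

theorem nearRadius_eq (h : Regime M β c g ε ℓ m) :
    M * g * nearRadius M β g ε = β * ε ^ 2 / 64 := by
  have hM := h.M_pos; have hg := h.g_pos
  rw [nearRadius]; field_simp

theorem innerRadius_eq (h : Regime M β c g ε ℓ m) :
    M * g * innerRadius M β g ε = (1 + β * ε ^ 2 / 8) / 2 := by
  have hM := h.M_pos; have hg := h.g_pos
  rw [innerRadius]; field_simp

theorem measureReal_near_le (h : Regime (f θ) β c g ε ℓ m)
    (hlo : ∀ x, f θ * (1 - c * (x - θ) ^ 2) ≤ f x)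
    (hY : ∀ s, Measurable (Y s)) (hlaw : ∀ s, μ.map (Y s) = law f) (hind : iIndepFun Y μ) :
    μ.real {ω | hits (fun s : Fin m => Y s ω)
      (Icc (θ - nearRadius (f θ) β g ε) (θ + nearRadius (f θ) β g ε)) ≤ 0} ≤
    Real.exp (-(4 * (ε * g) ^ 2)) := by
  have hprob : IsProbabilityMeasure (law f) :=
    hlaw 0 ▸ Measure.isProbabilityMeasure_map (hY 0).aemeasurable
  have hM := h.M_pos; have hg := h.g_pos
  have hs0 := h.nearRadius_pos
  have hse := h.nearRadius_eq
  have hβε := h.βε_le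
  set s := nearRadius (f θ) β g ε
  have hs1 : s ≤ 1 / (f θ * g) := by
    rw [le_div_iff₀ (by positivity)]; linarith
  have hmass : f θ * s ≤ (law f).real (Icc (θ - s) (θ + s)) := by
    refine le_trans ?_ (h.le_law_real_of_le hlo hs0.le hs1)
    have : 0 < f θ * s := by positivity
    nlinarith
  have key := measureReal_hits_le_le hY hlaw hind measurableSet_Icc m (l := 1 / 2)
    (m * (f θ * s)) hmass (by norm_num) (by norm_num)
  rw [sub_self] at key
  refine key.trans ?_
  rw [Real.exp_le_exp]
  have e : m * (f θ * s) = g ^ 4 * (β * ε ^ 2 / 64) := by rw [h.m_eq, ← hse]; ring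
  rw [e]
  have := mul_le_mul_of_nonneg_right h.β_g (sq_nonneg (ε * g))
  nlinarith

theorem measureReal_inner_le (h : Regime (f θ) β c g ε ℓ m)
    (hlo : ∀ x, f θ * (1 - c * (x - θ) ^ 2) ≤ f x)
    (hY : ∀ s, Measurable (Y s)) (hlaw : ∀ s, μ.map (Y s) = law f) (hind : iIndepFun Y μ) :
    μ.real {ω | hits (fun s : Fin m => Y s ω)
      (Icc (θ - (innerRadius (f θ) β g ε - nearRadius (f θ) β g ε))
        (θ + (innerRadius (f θ) β g ε - nearRadius (f θ) β g ε))) ≤ g ^ 4} ≤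
    Real.exp (-(β ^ 2 / 2048 * (ε * g) ^ 4)) := by
  have hprob : IsProbabilityMeasure (law f) :=
    hlaw 0 ▸ Measure.isProbabilityMeasure_map (hY 0).aemeasurable
  have hM := h.M_pos; have hg := h.g_pos; have hβ := h.β_pos
  have hβε := h.βε_le
  have hβε0 := h.βε_pos
  set t := innerRadius (f θ) β g ε - nearRadius (f θ) β g ε with ht
  have hte : f θ * g * t = (1 + 3 * (β * ε ^ 2) / 32) / 2 := by
    rw [ht, mul_sub, h.innerRadius_eq, h.nearRadius_eq]; ring
  have hMg : 0 < f θ * g := by positivity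
  have ht0 : 0 ≤ t := by
    by_contra! hneg
    have := mul_neg_of_pos_of_neg hMg hneg
    linarith
  have ht1 : t ≤ 1 / (f θ * g) := by
    rw [le_div_iff₀ hMg]; linarith
  have hmass : (1 + β * ε ^ 2 / 16) / g ≤ (law f).real (Icc (θ - t) (θ + t)) := by
    refine le_trans ?_ (h.le_law_real_of_le hlo ht0 ht1)
    rw [div_le_iff₀ hg]
    have e : f θ * (1 - β * ε ^ 2 / 64) * (2 * t) * g =
      (1 - β * ε ^ 2 / 64) * (1 + 3 * (β * ε ^ 2) / 32) := by
        calc _ = 2 * (1 - β * ε ^ 2 / 64) * (f θ * g * t) := by ring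
          _ = _ := by rw [hte]; ring
    rw [e]
    nlinarith
  have key := measureReal_hits_le_le hY hlaw hind measurableSet_Icc m (l := β * ε ^ 2 / 64)
    (g ^ 4 * (β * ε ^ 2 / 16)) hmass (by positivity) (by linarith)
  have e : m * ((1 + β * ε ^ 2 / 16) / g) = g ^ 4 * (1 + β * ε ^ 2 / 16) := by
    rw [h.m_eq]; field_simp
  rw [e] at key
  rw [show g ^ 4 * (1 + β * ε ^ 2 / 16) - g ^ 4 * (β * ε ^ 2 / 16) = g ^ 4 by ring] at key
  refine key.trans ?_
  rw [Real.exp_le_exp]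
  have h1 : g ^ 4 * (1 + β * ε ^ 2 / 16) * (β * ε ^ 2 / 64) ^ 2 ≤
      g ^ 4 * 2 * (β * ε ^ 2 / 64) ^ 2 := by gcongr; linarith
  nlinarith

/-- The exceptional probabilities of the coarse intervals add up to little more than the
probability for those at distance `ε`: the sum over the grid costs a power of `ℓ` only, because
the gap of the density grows quadratically with the distance to the mode. -/
theorem sum_exp_le (h : Regime M β c g ε ℓ m) {b : ℝ} (hb : 0 < b) :
    ∑ j ∈ farIndices g ε ℓ m,
      Real.exp (-(b * g ^ 4 * (|(j : ℝ)| * coarseMesh g ℓ) ^ 4)) ≤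
    2 * ℓ ^ 4 / b * (∑' j : ℤ, 1 / (j : ℝ) ^ 2) * Real.exp (-(b / 8 * (ε * g) ^ 4)) := by
  have hg := h.g_pos; have hl := h.ℓ_pos; have hε := h.ε_pos
  have hsumm : Summable fun j : ℤ => 1 / (j : ℝ) ^ 2 :=
    Real.summable_one_div_int_pow.2 one_lt_two
  have hterm : ∀ j ∈ farIndices g ε ℓ m,
      Real.exp (-(b * g ^ 4 * (|(j : ℝ)| * coarseMesh g ℓ) ^ 4)) ≤
      2 * ℓ ^ 4 / b * Real.exp (-(b / 8 * (ε * g) ^ 4)) * (1 / (j : ℝ) ^ 2) := by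
    intro j hj
    obtain ⟨-, hw1, -⟩ := Finset.mem_filter.1 hj
    have hj0 : j ≠ 0 := by
      rintro rfl
      simp at hw1
      linarith
    have hj1 : (1 : ℝ) ≤ (j : ℝ) ^ 2 := by
      have : (1 : ℤ) ≤ j ^ 2 := by
        have := sq_pos_of_ne_zero hj0
        omega
      exact_mod_cast this
    set u := b * g ^ 4 * (|(j : ℝ)| * coarseMesh g ℓ) ^ 4 with hu
    have hu1 : b / 4 * (ε * g) ^ 4 ≤ u := by
      calc b / 4 * (ε * g) ^ 4 ≤ b * g ^ 4 * (3 / 4 * ε) ^ 4 := by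
            have : 0 < b * (ε * g) ^ 4 := by positivity
            nlinarith
        _ ≤ u := by rw [hu]; gcongr
    have hu2 : u = b / ℓ ^ 4 * (j : ℝ) ^ 4 := by
      have : (j : ℝ) ^ 4 = |(j : ℝ)| ^ 4 := by
        rw [show 4 = 2 * 2 by rfl, pow_mul, pow_mul, sq_abs]
      rw [hu, coarseMesh, this]; field_simp
    have hu3 : b / ℓ ^ 4 * (j : ℝ) ^ 2 ≤ u := by
      rw [hu2]
      gcongr b / ℓ ^ 4 * ?_
      nlinarith
    have hv : 0 < b / ℓ ^ 4 * (j : ℝ) ^ 2 := by positivity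
    have hu0 : 0 < u := hv.trans_le hu3
    calc Real.exp (-u) = Real.exp (-(u / 2)) * Real.exp (-(u / 2)) := by
          rw [← Real.exp_add]; ring_nf
      _ ≤ Real.exp (-(b / 8 * (ε * g) ^ 4)) * (2 / (b / ℓ ^ 4 * (j : ℝ) ^ 2)) := by
          gcongr
          · linarith
          · rw [Real.exp_neg, ← one_div, div_le_div_iff₀ (Real.exp_pos _) hv]
            linarith [Real.add_one_le_exp (u / 2)]
      _ = _ := by field_simp
  refine (Finset.sum_le_sum hterm).trans ?_
  rw [← Finset.mul_sum]
  calc _ ≤ 2 * ℓ ^ 4 / b * Real.exp (-(b / 8 * (ε * g) ^ 4)) * ∑' j : ℤ, 1 / (j : ℝ) ^ 2 := by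
        gcongr
        exact hsumm.sum_le_tsum _ fun j _ => by positivity
    _ = _ := by ring

/-- Union bound over the exceptional events. -/
theorem measureReal_isSampleMode_far_le (h : Regime (f θ) β c g ε ℓ m) (hf : IsModalDensity f)
    (hθ : IsMode f θ)
    (hup : ∀ x, |x - θ| ≤ 4 → f x ≤ f θ * (1 - β * (x - θ) ^ 2))
    (hlo : ∀ x, f θ * (1 - c * (x - θ) ^ 2) ≤ f x)
    (hY : ∀ s, Measurable (Y s)) (hlaw : ∀ s, μ.map (Y s) = law f) (hind : iIndepFun Y μ) :
    μ.real {ω | ∃ z, IsSampleMode (fun s : Fin m => Y s ω) z ∧ ε < |z - θ|} ≤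
      2 * ℓ ^ 4 / (β ^ 2 / 2048) * (∑' j : ℤ, 1 / (j : ℝ) ^ 2) *
        Real.exp (-(β ^ 2 / 2048 / 8 * (ε * g) ^ 4)) +
      12 * m ^ 2 * Real.exp (-(4 * ℓ + 4 * (ε * g) ^ 2)) +
      Real.exp (-(4 * (ε * g) ^ 2)) + Real.exp (-(β ^ 2 / 2048 * (ε * g) ^ 4)) := by
  have hg := h.g_pos
  have hm0 : 0 < m := by exact_mod_cast h.m_pos
  have hk : (m : ℝ) ^ (4 / 5 : ℝ) = g ^ 4 := by
    rw [h.m_eq, ← Real.rpow_natCast g 5, ← Real.rpow_mul hg.le, ← Real.rpow_natCast g 4]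
    norm_num
  set σ := coarseMesh g ℓ / m with hσ
  set p : ℤ → ℝ := fun j => θ + j * coarseMesh g ℓ
  set p' : ℤ → ℝ := fun j => p j + (2 * outerRadius (f θ) β g ε - coarseMesh g ℓ)
  set lev : ℕ → ℝ := fun i => m * (f θ * (i * σ)) + g ^ 4 * (β * ε ^ 2 / 64)
  set J := farIndices g ε ℓ m with hJ
  set E0 : Set Ω := {ω | ∃ s : Fin m, Y s ω ∉ Icc (0 : ℝ) 1}
  set E1 : Set Ω := {ω | hits (fun s : Fin m => Y s ω)
      (Icc (θ - nearRadius (f θ) β g ε) (θ + nearRadius (f θ) β g ε)) ≤ 0}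
  set E2 : Set Ω := {ω | hits (fun s : Fin m => Y s ω)
      (Icc (θ - (innerRadius (f θ) β g ε - nearRadius (f θ) β g ε))
        (θ + (innerRadius (f θ) β g ε - nearRadius (f θ) β g ε))) ≤ g ^ 4}
  set E3 : ℤ → Set Ω := fun j =>
    {ω | m * farMass (f θ) β g ε ℓ (|(j : ℝ)| * coarseMesh g ℓ) +
        g ^ 4 * (β * (|(j : ℝ)| * coarseMesh g ℓ) ^ 2 / 16) ≤
      hits (fun s : Fin m => Y s ω) (Icc (p j) (p' j))}
  set E4 : ℤ → ℕ → Set Ω := fun j i =>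
    {ω | lev i ≤ hits (fun s : Fin m => Y s ω) (Icc (p j - i * σ) (p j))}
  set E5 : ℤ → ℕ → Set Ω := fun j i =>
    {ω | lev i ≤ hits (fun s : Fin m => Y s ω) (Icc (p' j) (p' j + i * σ))}
  have hsub : {ω | ∃ z, IsSampleMode (fun s : Fin m => Y s ω) z ∧ ε < |z - θ|} ⊆
      E0 ∪ (⋃ j ∈ J, E3 j) ∪ (⋃ j ∈ J, ⋃ i ∈ Finset.range (m + 1), (E4 j i ∪ E5 j i)) ∪ E1 ∪
        E2 := by
    rintro ω ⟨z, hz, hzε⟩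
    by_contra hω
    simp only [mem_union, mem_iUnion, not_or, not_exists] at hω
    obtain ⟨⟨⟨⟨h0, h3⟩, h45⟩, h1⟩, h2⟩ := hω
    have h01 : ∀ s : Fin m, Y s ω ∈ Icc (0 : ℝ) 1 := fun s => by
      by_contra hs
      exact h0 ⟨s, hs⟩
    refine not_le.2 hzε (hz.abs_sub_le hm0 h.inner_lt_outer (not_le.1 h1) ?_ fun l hl => ?_)
    · rw [hk]; exact (not_le.1 h2).le
    · rw [hk]
      have hθ01 := hf.mode_mem_Ioo hθ
      refine h.hits_outer_lt (θ := θ) (abs_le.2 ⟨?_, ?_⟩) hl (fun j hj => not_le.1 (h3 j hj))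
        (fun j hj i hi => not_le.1 (h45 j hj i hi).1)
        (fun j hj i hi => not_le.1 (h45 j hj i hi).2)
      · linarith [(h01 l).1, hθ01.2]
      · linarith [(h01 l).2, hθ01.1]
  have b0 : μ.real E0 = 0 := by
    have : E0 = ⋃ s : Fin m, Y s ⁻¹' (Icc 0 1)ᶜ := by ext ω; simp [E0]
    rw [this, measureReal_def, measure_iUnion_null fun s => ?_, ENNReal.toReal_zero]
    rw [← Measure.map_apply (hY s) measurableSet_Icc.compl, hlaw, hf.law_compl_Icc]
  have b3 : μ.real (⋃ j ∈ J, E3 j) ≤ 2 * ℓ ^ 4 / (β ^ 2 / 2048) *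
      (∑' j : ℤ, 1 / (j : ℝ) ^ 2) * Real.exp (-(β ^ 2 / 2048 / 8 * (ε * g) ^ 4)) :=
    (measureReal_biUnion_finset_le _ _).trans ((Finset.sum_le_sum fun j hj =>
      h.measureReal_coarse_le hup hY hlaw hind hj).trans
      (h.sum_exp_le (by have := h.β_pos; positivity)))
  have b45 : μ.real (⋃ j ∈ J, ⋃ i ∈ Finset.range (m + 1), (E4 j i ∪ E5 j i)) ≤
      12 * m ^ 2 * Real.exp (-(4 * ℓ + 4 * (ε * g) ^ 2)) := by
    have hJcard : (J.card : ℝ) ≤ 2 * m + 1 := by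
      have : J.card ≤ 2 * m + 1 := by
        refine (Finset.card_filter_le _ _).trans ?_
        rw [Int.card_Icc]; omega
      exact_mod_cast this
    have hm1 : (1 : ℝ) ≤ m := by exact_mod_cast hm0
    set e := Real.exp (-(4 * ℓ + 4 * (ε * g) ^ 2))
    have he : 0 < e := Real.exp_pos _
    have hone : ∀ j, ∀ i ∈ Finset.range (m + 1), μ.real (E4 j i ∪ E5 j i) ≤ 2 * e := by
      intro j i hi
      have hi' : i ≤ m := by rw [Finset.mem_range] at hi; omega
      have e4 := h.measureReal_edge_le hθ hY hlaw hind (p j - i * σ) hi'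
      rw [← hσ, sub_add_cancel] at e4
      have e5 := h.measureReal_edge_le hθ hY hlaw hind (p' j) hi'
      calc _ ≤ μ.real (E4 j i) + μ.real (E5 j i) := measureReal_union_le _ _
        _ ≤ e + e := add_le_add e4 e5
        _ = 2 * e := by ring
    calc _ ≤ ∑ _j ∈ J, ∑ _i ∈ Finset.range (m + 1), 2 * e :=
          (measureReal_biUnion_finset_le _ _).trans (Finset.sum_le_sum fun j _ =>
            (measureReal_biUnion_finset_le _ _).trans (Finset.sum_le_sum fun i hi => hone j i hi))
      _ = J.card * ((m + 1) * (2 * e)) := by simp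
      _ ≤ (2 * m + 1) * ((m + 1) * (2 * e)) := by gcongr
      _ ≤ (3 * m) * ((2 * m) * (2 * e)) := by gcongr <;> linarith
      _ = 12 * m ^ 2 * e := by ring
  have b1 := h.measureReal_near_le hlo hY hlaw hind
  have b2 := h.measureReal_inner_le hlo hY hlaw hind
  refine (measureReal_mono hsub).trans ((measureReal_union_le _ _).trans (add_le_add
    ((measureReal_union_le _ _).trans (add_le_add ((measureReal_union_le _ _).trans
      (add_le_add ((measureReal_union_le _ _).trans ?_) b45)) b1)) b2))
  rw [b0, zero_add]
  exact b3

end Probability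

end Regime

/-! ### Tail of the sample mode -/

universe u

/-- The tail estimate for the sample mode of `f`, valid once the sample size is at least `G ^ 5` and
the accuracy `ε` is at least `T` times the natural scale `m ^ (-1 / 5)`. The condition on `log m`
rules out accuracies for which a power of `log m` could not be absorbed. -/
def HasModeTail (f : ℝ → ℝ) (T G : ℝ) : Prop :=
  ∀ (θ : ℝ) (_ : IsMode f θ) (m : ℕ) (g ε : ℝ) (_ : (m : ℝ) = g ^ 5) (_ : G ≤ g)
    (_ : 0 < ε) (_ : ε ≤ 1) (_ : T ≤ ε * g) (_ : Real.log m ≤ 1024 * (ε * g) ^ 5)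
    (Ω : Type u) [MeasurableSpace Ω] (μ : Measure Ω) [IsProbabilityMeasure μ]
    (Y : ℕ → Ω → ℝ) (_ : ∀ s, Measurable (Y s)) (_ : ∀ s, μ.map (Y s) = law f)
    (_ : iIndepFun Y μ),
    μ.real {ω | ∃ z, IsSampleMode (fun s : Fin m => Y s ω) z ∧ ε < |z - θ|} ≤
      Real.exp (-(ε * g) ^ 2) / 2

theorem exp_neg_four_sq_le {T : ℝ} (hT : 1 ≤ T) :
    Real.exp (-(4 * T ^ 2)) ≤ Real.exp (-T ^ 2) / 8 := by
  have h1 : 1 ≤ T ^ 2 := one_le_pow₀ hT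
  have h2 : Real.exp (-3) ≤ 1 / 8 := by
    rw [Real.exp_neg, ← one_div]
    have : (8 : ℝ) ≤ Real.exp 3 := by
      have h := Real.exp_one_gt_d9.le
      calc (8 : ℝ) ≤ 2.7182818283 ^ 3 := by norm_num
        _ ≤ Real.exp 1 ^ 3 := by gcongr
        _ = Real.exp 3 := by rw [← Real.exp_nat_mul]; norm_num
    exact one_div_le_one_div_of_le (by norm_num) this
  calc Real.exp (-(4 * T ^ 2)) ≤ Real.exp (-T ^ 2 + -3) := by
        rw [Real.exp_le_exp]; linarith
    _ = Real.exp (-T ^ 2) * Real.exp (-3) := Real.exp_add _ _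
    _ ≤ Real.exp (-T ^ 2) * (1 / 8) := by gcongr
    _ = _ := by ring

/-- For accuracies `T` that are large on the natural scale, all terms of the union bound are
dominated by a Gaussian tail in `T`. -/
theorem exceptional_sum_le {T ℓ b Z : ℝ} {m : ℕ} (hT : 4 ≤ T) (hb : 16 ≤ T * b) (hb0 : 0 < b)
    (hZ0 : 0 ≤ Z) (hℓ0 : 0 ≤ ℓ) (hℓT : ℓ ≤ 1024 * T ^ 5) (hℓm : Real.exp ℓ = m)
    (hm : (4 : ℝ) ≤ m) (hlim : 2 * 1024 ^ 4 / b * Z * (T ^ 20 * Real.exp (-T)) ≤ 1 / 8) :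
    2 * ℓ ^ 4 / b * Z * Real.exp (-(b / 8 * T ^ 4)) +
      12 * m ^ 2 * Real.exp (-(4 * ℓ + 4 * T ^ 2)) +
      Real.exp (-(4 * T ^ 2)) + Real.exp (-(b * T ^ 4)) ≤ Real.exp (-T ^ 2) / 2 := by
  have hTT : T ≤ T ^ 2 := le_self_pow₀ (by linarith) (by norm_num)
  have hbT4 : 16 * T ^ 2 ≤ b * T ^ 4 := by
    calc 16 * T ^ 2 ≤ T * b * T ^ 2 := by gcongr
      _ ≤ T ^ 2 * b * T ^ 2 := by gcongr
      _ = b * T ^ 4 := by ring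
  have p4 := exp_neg_four_sq_le (T := T) (by linarith)
  have p1 : 2 * ℓ ^ 4 / b * Z * Real.exp (-(b / 8 * T ^ 4)) ≤ Real.exp (-T ^ 2) / 8 := by
    have hexp : Real.exp (-(b / 8 * T ^ 4)) ≤ Real.exp (-T ^ 2 + -T) := by
      rw [Real.exp_le_exp]; linarith
    have hpow : ℓ ^ 4 ≤ (1024 * T ^ 5) ^ 4 := pow_le_pow_left₀ hℓ0 hℓT 4
    calc 2 * ℓ ^ 4 / b * Z * Real.exp (-(b / 8 * T ^ 4))
        ≤ 2 * (1024 * T ^ 5) ^ 4 / b * Z * Real.exp (-T ^ 2 + -T) := by gcongr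
      _ = 2 * 1024 ^ 4 / b * Z * (T ^ 20 * Real.exp (-T)) * Real.exp (-T ^ 2) := by
          rw [Real.exp_add]; ring
      _ ≤ 1 / 8 * Real.exp (-T ^ 2) := mul_le_mul_of_nonneg_right hlim (Real.exp_nonneg _)
      _ = _ := by ring
  have p2 : 12 * m ^ 2 * Real.exp (-(4 * ℓ + 4 * T ^ 2)) ≤ Real.exp (-T ^ 2) / 8 := by
    have hm0 : (0 : ℝ) < m := by linarith
    have e : Real.exp (-(4 * ℓ + 4 * T ^ 2)) = Real.exp (-(4 * T ^ 2)) / (m : ℝ) ^ 4 := by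
      have : Real.exp (4 * ℓ) = (m : ℝ) ^ 4 := by
        rw [← hℓm, ← Real.exp_nat_mul]; norm_num
      rw [neg_add, add_comm, Real.exp_add, Real.exp_neg (4 * ℓ), this, div_eq_mul_inv]
    have h2 : (12 : ℝ) ≤ m ^ 2 := by nlinarith
    have hm12 : 12 * (m : ℝ) ^ 2 ≤ (m : ℝ) ^ 4 := by
      calc 12 * (m : ℝ) ^ 2 ≤ m ^ 2 * m ^ 2 := mul_le_mul_of_nonneg_right h2 (sq_nonneg _)
        _ = (m : ℝ) ^ 4 := by ring
    refine le_trans ?_ p4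
    rw [e, mul_div_assoc', div_le_iff₀ (by positivity), mul_comm]
    exact mul_le_mul_of_nonneg_left hm12 (Real.exp_nonneg _)
  have p3 : Real.exp (-(b * T ^ 4)) ≤ Real.exp (-T ^ 2) / 8 :=
    le_trans (Real.exp_le_exp.2 (by linarith)) p4
  linarith

theorem IsModalDensity.exists_hasModeTail {f : ℝ → ℝ} (hf : IsModalDensity f) :
    ∃ T G : ℝ, 4 ≤ T ∧ 0 ≤ G ∧ HasModeTail.{u} f T G := by
  obtain ⟨θ, hθ, huniq⟩ := hf.existsUnique_mode
  obtain ⟨β, hβ, hβ1, c, hc, hup, hlo⟩ := hf.exists_quadratic_bounds hθ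
  have hM := hf.apply_mode_pos hθ
  set M := f θ
  set b := β ^ 2 / 2048
  have hb0 : 0 < b := by positivity
  set Z := ∑' j : ℤ, 1 / (j : ℝ) ^ 2
  have hZ0 : 0 ≤ Z := tsum_nonneg fun j => by positivity
  set C := 2 * 1024 ^ 4 / b * Z
  have hlim : ∀ᶠ T : ℝ in atTop, C * (T ^ 20 * Real.exp (-T)) < 1 / 8 := by
    have := (Real.tendsto_pow_mul_exp_neg_atTop_nhds_zero 20).const_mul C
    rw [mul_zero] at this
    exact this.eventually (gt_mem_nhds (by norm_num))
  obtain ⟨T₀, hT₀⟩ := eventually_atTop.1 (hlim.and ((eventually_ge_atTop 4).and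
    ((eventually_ge_atTop (24 / M)).and ((eventually_ge_atTop (64 * c / (M ^ 2 * β))).and
    ((eventually_ge_atTop (256 * M * (512 / β) / β)).and (eventually_ge_atTop (16 / b)))))))
  obtain ⟨G₀, hG₀⟩ := eventually_atTop.1 ((eventually_ge_atTop (4 : ℝ)).and
    ((Real.tendsto_log_atTop.eventually_ge_atTop (max 1 (12 * M))).and
    ((eventually_ge_atTop (64 * M / β)).and (eventually_ge_atTop (512 / β * 6)))))
  refine ⟨T₀, max G₀ 0, (hT₀ T₀ le_rfl).2.1, le_max_right _ _, ?_⟩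
  intro θ' hθ' m g ε hm hg hε hε1 hT hlog Ω _ μ _ Y hY hlaw hind
  obtain rfl : θ' = θ := huniq θ' hθ'
  obtain ⟨t1, t2, t3, t4, t5, t6⟩ := hT₀ _ hT
  obtain ⟨g1, g2, g3, g4⟩ := hG₀ _ ((le_max_left _ _).trans hg)
  have hg0 : 0 < g := by linarith
  have hTT : ε * g ≤ (ε * g) ^ 2 := by nlinarith
  have hlogm : Real.log m = 5 * Real.log g := by
    rw [hm, Real.log_pow]; norm_num
  have hlg : Real.log g ≤ g := (Real.log_le_sub_one_of_pos hg0).trans (by linarith)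
  have hm0 : (0 : ℝ) < m := by rw [hm]; positivity
  have hg2 : 1 ≤ Real.log g := (le_max_left _ _).trans g2
  have hg3 : 12 * M ≤ Real.log g := (le_max_right _ _).trans g2
  rw [div_le_iff₀ hM] at t3
  rw [div_le_iff₀ (by positivity)] at t4
  rw [div_le_iff₀ hβ] at t5
  rw [div_le_iff₀ hb0] at t6
  rw [div_le_iff₀ hβ] at g3
  have h512 : 512 * 6 ≤ g * β := by
    have : 512 / β * 6 = 512 * 6 / β := by ring
    rwa [this, div_le_iff₀ hβ] at g4
  have hreg : Regime (f θ') β c g ε (Real.log m) m := by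
    refine ⟨hM, hβ, hβ1, hc, by linarith, hε, hε1, hm, Real.exp_log hm0, ?_, ?_, ?_, ?_, ?_, ?_,
      by linarith, by linarith, ?_, ?_⟩
    · linarith
    · linarith
    · rw [hlogm]
      have : 4 ^ 3 ≤ g ^ 3 := by gcongr
      nlinarith
    · have : g * β ≤ g ^ 3 * β := by
        gcongr
        exact le_self_pow₀ (by linarith) (by norm_num)
      linarith
    · have : g * β ≤ g ^ 2 * β := by
        gcongr
        exact le_self_pow₀ (by linarith) (by norm_num)
      linarith
    · calc 512 / β * (Real.log m + 1) ≤ 512 / β * (6 * g) := by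
            gcongr; rw [hlogm]; linarith
        _ = 512 / β * 6 * g := by ring
        _ ≤ g * g := by gcongr
        _ = g ^ 2 := by ring
    · calc 64 * c ≤ ε * g * (M ^ 2 * β) := t4
        _ ≤ (ε * g) ^ 2 * (M ^ 2 * β) := by gcongr
        _ = _ := by ring
    · calc _ ≤ ε * g * β := t5
        _ ≤ (ε * g) ^ 2 * β := by gcongr
        _ = _ := by ring
  refine (hreg.measureReal_isSampleMode_far_le hf hθ hup hlo hY hlaw hind).trans ?_
  have hm4 : (4 : ℝ) ≤ m := by
    calc (4 : ℝ) ≤ 4 ^ 5 := by norm_num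
      _ ≤ m := by rw [hm]; gcongr
  exact exceptional_sum_le t2 t6 hb0 hZ0 (by rw [hlogm]; linarith) hlog (Real.exp_log hm0) hm4
    t1.le

/-! ### Pull counts under uniform sampling -/

section Sampling

variable {K : ℕ} {I : ℕ → Fin K} {n : ℕ}

theorem pullCount_succ (i : Fin K) (t : ℕ) :
    pullCount I i (t + 1) = pullCount I i t + if I t = i then 1 else 0 := by
  rw [pullCount, pullCount, Finset.range_add_one, Finset.filter_insert]
  split_ifs <;> simp

theorem sum_pullCount (t : ℕ) : ∑ i, pullCount I i t = t := by
  have := Finset.card_eq_sum_card_fiberwise (s := Finset.range t) (f := I)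
    (t := Finset.univ) (fun _ _ => Finset.mem_coe.2 (Finset.mem_univ _))
  rw [Finset.card_range] at this
  exact this.symm

theorem IsUniformSampling.pullCount_le_add_one (h : IsUniformSampling I n) (i j : Fin K) :
    ∀ t ≤ n, pullCount I i t ≤ pullCount I j t + 1 := by
  intro t
  induction t with
  | zero => simp [pullCount]
  | succ t ih =>
    intro ht
    have := h t (by omega) j
    have := ih (by omega)
    rw [pullCount_succ, pullCount_succ]
    split_ifs <;> simp_all
    all_goals omega

theorem IsUniformSampling.pullCount_mem (h : IsUniformSampling I n) (hK : 0 < K) (i : Fin K) :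
    pullCount I i n ∈ ({n / K, n / K + 1} : Finset ℕ) := by
  have hle := fun j => h.pullCount_le_add_one i j n le_rfl
  have hge := fun j => h.pullCount_le_add_one j i n le_rfl
  have hsum := sum_pullCount (I := I) n
  have h1 : K * (n / K) ≤ n := Nat.mul_div_le n K
  have h2 : n < K * (n / K + 1) := Nat.lt_mul_div_succ n hK
  have hlow : n / K ≤ pullCount I i n := by
    by_contra! hlt
    have : ∑ j, pullCount I j n < ∑ _j : Fin K, n / K :=
      Finset.sum_lt_sum (fun j _ => by have := hge j; omega) ⟨i, Finset.mem_univ i, hlt⟩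
    simp at this
    omega
  have hhigh : pullCount I i n ≤ n / K + 1 := by
    by_contra! hlt
    have : ∑ _j : Fin K, (n / K + 1) ≤ ∑ j, pullCount I j n :=
      Finset.sum_le_sum fun j _ => by have := hle j; omega
    simp at this
    omega
  simp only [Finset.mem_insert, Finset.mem_singleton]
  omega

end Sampling

/-! ### From the sample size to the accuracy -/

/-- The sample size `m`, measured by `T ^ 5 = (ε / 2) ^ 5 * m`, is large compared with the confidence
parameter `L`. The term involving `t`, an upper bound for `ε`, covers accuracies close to `1`, where
`log (ε ^ (-5))` degenerates. -/
theorem scale_bounds {L ε m T T₀ t : ℝ} (hL : Real.log 2 ≤ L) (hε : 0 < ε) (hεt : ε < t)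
    (ht : t < 1) (hT0 : 0 < T) (hT : 32 * T ^ 5 = ε ^ 5 * m)
    (hm : L ^ 5 * ε ^ (-5 : ℤ) * Real.log (ε ^ (-5 : ℤ)) ≤ 2 * m) (hT₀ : 4 ≤ T₀)
    (hmT : 32 * T₀ ^ 5 * Real.exp (430 * T₀ ^ 5) ≤ m) (hmt : 2 ^ 14 ≤ m * (1 - t)) :
    T₀ ≤ T ∧ Real.log m ≤ 1024 * T ^ 5 ∧ L ≤ T ^ 2 := by
  set Λ := Real.log (ε ^ (-5 : ℤ)) with hΛ
  have hΛε : Λ = -(5 * Real.log ε) := by rw [hΛ, Real.log_zpow]; push_cast; ring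
  have hm0 : 0 < m := lt_of_lt_of_le (by positivity) hmT
  have hΛ1 : 5 * (1 - ε) ≤ Λ := by
    rw [hΛε]; linarith [Real.log_le_sub_one_of_pos hε]
  have hΛ0 : 0 < Λ := by linarith
  have hεexp : ε ^ 5 = Real.exp (-Λ) := by
    rw [hΛε, neg_neg, ← Real.exp_log hε, ← Real.exp_nat_mul, Real.log_exp]; norm_num
  have hLT : L ^ 5 * Λ ≤ 64 * T ^ 5 := by
    have e : L ^ 5 * ε ^ (-5 : ℤ) * Λ = L ^ 5 * Λ / ε ^ 5 := by
      rw [zpow_neg]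
      norm_cast
      rw [div_eq_mul_inv]; ring
    rw [e, div_le_iff₀ (by positivity)] at hm
    linarith
  have hL5 : 0.15 ≤ L ^ 5 := by
    have h := Real.log_two_gt_d9
    calc (0.15 : ℝ) ≤ 0.69 ^ 5 := by norm_num
      _ ≤ L ^ 5 := by gcongr; linarith
  have hΛT : Λ ≤ 430 * T ^ 5 := by nlinarith
  have h1 : T₀ ≤ T := by
    rw [← pow_le_pow_iff_left₀ (by linarith) hT0.le (by norm_num : (5 : ℕ) ≠ 0)]
    rcases le_total (430 * T₀ ^ 5) Λ with h | h
    · linarith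
    -- `ε` is bounded below, so a large `m` makes `T` large
    · have h2 : Real.exp (-(430 * T₀ ^ 5)) ≤ ε ^ 5 := by
        rw [hεexp, Real.exp_le_exp]; linarith
      have h3 : Real.exp (-(430 * T₀ ^ 5)) * (32 * T₀ ^ 5 * Real.exp (430 * T₀ ^ 5)) ≤
          ε ^ 5 * m := by gcongr
      have h4 : Real.exp (-(430 * T₀ ^ 5)) * (32 * T₀ ^ 5 * Real.exp (430 * T₀ ^ 5)) =
          32 * T₀ ^ 5 := by
        rw [mul_comm, mul_assoc, ← Real.exp_add]; simp
      linarith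
  have hT5 : 4 ^ 5 ≤ T ^ 5 := by gcongr; linarith
  refine ⟨h1, ?_, ?_⟩
  · have e : m = 32 * T ^ 5 * Real.exp Λ := by
      have : Real.exp (-Λ) * Real.exp Λ = 1 := by rw [← Real.exp_add]; simp
      rw [hT, hεexp, mul_right_comm, this, one_mul]
    rw [e, Real.log_mul (by positivity) (Real.exp_ne_zero _), Real.log_exp]
    have := Real.log_le_sub_one_of_pos (show 0 < 32 * T ^ 5 by positivity)
    linarith
  · have hL0 : 0 ≤ L := (Real.log_nonneg (by norm_num)).trans hL
    rw [← pow_le_pow_iff_left₀ hL0 (by positivity) (by norm_num : (5 : ℕ) ≠ 0)]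
    have hprod : 64 ≤ Λ * T ^ 5 := by
      rcases le_total 1 Λ with h | h
      · nlinarith
      -- here `ε` is bounded below, and `Λ ≥ 5 * (1 - t)`
      · have h2 : 1 / 3 ≤ ε ^ 5 := by
          rw [hεexp]
          have h3 : Real.exp 1 ≤ 3 := Real.exp_one_lt_d9.le.trans (by norm_num)
          calc (1 : ℝ) / 3 ≤ 1 / Real.exp 1 := one_div_le_one_div_of_le (Real.exp_pos _) h3
            _ = Real.exp (-1) := by rw [Real.exp_neg, one_div]
            _ ≤ Real.exp (-Λ) := by rw [Real.exp_le_exp]; linarith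
        have h4 : m / 96 ≤ T ^ 5 := by nlinarith
        calc (64 : ℝ) ≤ 5 * (m * (1 - t)) / 96 := by linarith
          _ = 5 * (1 - t) * (m / 96) := by ring
          _ ≤ Λ * T ^ 5 := by
            gcongr
            linarith
    calc L ^ 5 ≤ L ^ 5 * (Λ * T ^ 5 / 64) := le_mul_of_one_le_right (by positivity) (by linarith)
      _ = L ^ 5 * Λ * T ^ 5 / 64 := by ring
      _ ≤ 64 * T ^ 5 * T ^ 5 / 64 := by gcongr
      _ = (T ^ 2) ^ 5 := by ring

/-- A sample size beyond which the tail estimate applies to `f` at every admissible accuracy. -/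
def IsThreshold (f : ℝ → ℝ) (N : ℕ) : Prop :=
  ∃ T G : ℝ, 4 ≤ T ∧ 0 ≤ G ∧ HasModeTail.{u} f T G ∧ G ^ 5 ≤ N ∧
    32 * T ^ 5 * Real.exp (430 * T ^ 5) ≤ N ∧ ∀ θ, IsMode f θ → 2 ^ 14 ≤ N * (1 - θ)

theorem IsModalDensity.exists_isThreshold {f : ℝ → ℝ} (hf : IsModalDensity f) :
    ∃ N, IsThreshold.{u} f N := by
  obtain ⟨T, G, hT, hG, htail⟩ := hf.exists_hasModeTail
  obtain ⟨θ, hθ, huniq⟩ := hf.existsUnique_mode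
  have hθ1 : 0 < 1 - θ := sub_pos.2 (hf.mode_mem_Ioo hθ).2
  obtain ⟨N, hN⟩ := exists_nat_ge
    (max (G ^ 5) (max (32 * T ^ 5 * Real.exp (430 * T ^ 5)) (2 ^ 14 / (1 - θ))))
  refine ⟨N, T, G, hT, hG, htail, (le_max_left _ _).trans hN,
    ((le_max_left _ _).trans (le_max_right _ _)).trans hN, fun θ' hθ' => ?_⟩
  rw [huniq θ' hθ', ← div_le_iff₀ hθ1]
  exact ((le_max_right _ _).trans (le_max_right _ _)).trans hN

/-- The probability that the sample mode of `m` rewards of one arm misses the mode by more than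
`ε / 2`. Only an accuracy `ε` below the mode `t` of some arm has to be considered, since otherwise
all arms are `ε`-optimal. -/
theorem IsThreshold.measureReal_isSampleMode_le {f : ℝ → ℝ} {N m : ℕ} (h : IsThreshold.{u} f N)
    (hNm : N ≤ m) {θ : ℝ} (hθ : IsMode f θ) {L ε t : ℝ} (hL : Real.log 2 ≤ L) (hε : 0 < ε)
    (hεt : ε < t) (ht : t < 1) (hmt : 2 ^ 14 ≤ m * (1 - t))
    (hm : L ^ 5 * ε ^ (-5 : ℤ) * Real.log (ε ^ (-5 : ℤ)) ≤ 2 * m)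
    {Ω : Type u} [MeasurableSpace Ω] {μ : Measure Ω} [IsProbabilityMeasure μ] {Y : ℕ → Ω → ℝ}
    (hY : ∀ s, Measurable (Y s)) (hlaw : ∀ s, μ.map (Y s) = law f) (hind : iIndepFun Y μ) :
    μ.real {ω | ∃ z, IsSampleMode (fun s : Fin m => Y s ω) z ∧ ε / 2 < |z - θ|} ≤
      Real.exp (-L) / 2 := by
  obtain ⟨T₀, G, hT₀, hG, htail, hGN, hTN, -⟩ := h
  have hNm' : (N : ℝ) ≤ m := by exact_mod_cast hNm
  have hm0 : (0 : ℝ) < m := lt_of_lt_of_le (by positivity) (hTN.trans hNm')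
  set g := (m : ℝ) ^ (1 / 5 : ℝ) with hg
  have hg0 : 0 < g := Real.rpow_pos_of_pos hm0 _
  have hg5 : (m : ℝ) = g ^ 5 := by
    rw [hg, ← Real.rpow_natCast, ← Real.rpow_mul hm0.le]; norm_num
  obtain ⟨h1, h2, h3⟩ := scale_bounds (T := ε / 2 * g) hL hε hεt ht (by positivity)
    (by rw [hg5]; ring) hm hT₀ (hTN.trans hNm') hmt
  have hGg : G ≤ g := by
    rw [← pow_le_pow_iff_left₀ hG hg0.le (by norm_num : (5 : ℕ) ≠ 0), ← hg5]
    exact hGN.trans hNm'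
  refine (htail θ hθ m g (ε / 2) hg5 hGg (by positivity) (by linarith) h1 h2 Ω μ Y hY hlaw
    hind).trans ?_
  gcongr

end ModalBandit

theorem mainTheorem7 :
    ∃ N : (ℝ → ℝ) → ℕ,
      ∀ (K : ℕ) (_hK : 0 < K) (f : Fin K → ℝ → ℝ) (_hf : ∀ i, ModalBandit.IsModalDensity (f i))
        (θ : Fin K → ℝ) (_hθ : ∀ i, ModalBandit.IsMode (f i) (θ i))
        (ε δ : ℝ) (_hε : 0 < ε) (_hδ₀ : 0 < δ) (_hδ₁ : δ < 1) (n : ℕ)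
        (_hn : max
            (K * (Real.log K + Real.log (1 / δ)) ^ 5 * ε ^ (-5 : ℤ) * Real.log (ε ^ (-5 : ℤ)))
            (K * ((Finset.univ.sup fun i => N (f i) : ℕ) : ℝ)) ≤ (n : ℝ))
        (Ω : Type*) [MeasurableSpace Ω] (μ : Measure Ω) [IsProbabilityMeasure μ]
        (X : Fin K → ℕ → Ω → ℝ) (_hX : ∀ i s, Measurable (X i s))
        (_hlaw : ∀ i s, μ.map (X i s) = ModalBandit.law (f i))
        (_hind : iIndepFun (fun p : Fin K × ℕ => X p.1 p.2) μ)
        (I : Ω → ℕ → Fin K) (_hI : ∀ ω, ModalBandit.IsUniformSampling (I ω) n)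
        (θhat : Ω → Fin K → ℝ)
        (_hθhat : ∀ ω i, ModalBandit.IsSampleMode
          (ModalBandit.observed (fun i s => X i s ω) (I ω) n i) (θhat ω i))
        (best : Ω → Fin K) (_hbest : ∀ ω j, θhat ω j ≤ θhat ω (best ω)),
        1 - δ ≤ μ.real {ω | ∀ j, θ j - θ (best ω) ≤ ε} := by
  classical
  refine ⟨fun f => if h : ModalBandit.IsModalDensity f then h.exists_isThreshold.choose else 0, ?_⟩
  intro K hK f hf θ hθ ε δ hε hδ₀ hδ₁ n hn Ω _ μ _ X hX hlaw hind I hI θhat hθhat best hbest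
  by_cases htriv : ∀ j i, θ j - θ i ≤ ε
  · have : {ω | ∀ j, θ j - θ (best ω) ≤ ε} = univ := eq_univ_of_forall fun ω j => htriv j _
    rw [this, probReal_univ]
    linarith
  push Not at htriv
  obtain ⟨j₀, i₀, hji⟩ := htriv
  set N : (ℝ → ℝ) → ℕ :=
    fun f => if h : ModalBandit.IsModalDensity f then h.exists_isThreshold.choose else 0 with hN
  have hthr : ∀ i, ModalBandit.IsThreshold (f i) (N (f i)) := fun i => by
    simp only [hN, hf i, dif_pos]
    exact (hf i).exists_isThreshold.choose_spec
  have hK0 : (0 : ℝ) < K := by exact_mod_cast hK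
  -- two arms are not within `ε` of each other, so there are at least two arms and `ε < 1`
  have hK2 : (2 : ℝ) ≤ K := by
    have hne : j₀ ≠ i₀ := by rintro rfl; linarith
    have : 1 < K := by
      simpa using Fintype.one_lt_card_iff.2 ⟨j₀, i₀, hne⟩
    exact_mod_cast this
  have hεt : ε < θ j₀ := by linarith [((hf i₀).mode_mem_Ioo (hθ i₀)).1]
  have ht1 : θ j₀ < 1 := ((hf j₀).mode_mem_Ioo (hθ j₀)).2
  set L := Real.log K + Real.log (1 / δ) with hLdef
  have hL : Real.log 2 ≤ L := by
    have h1 : Real.log 2 ≤ Real.log K := Real.log_le_log (by norm_num) hK2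
    have h2 : 0 ≤ Real.log (1 / δ) := Real.log_nonneg (one_le_one_div hδ₀ hδ₁.le)
    linarith
  have hexpL : Real.exp (-L) = δ / K := by
    rw [hLdef, ← Real.log_mul hK0.ne' (by positivity), Real.exp_neg,
      Real.exp_log (by positivity)]
    field_simp
  set q := n / K with hq
  have hNq : ∀ i, N (f i) ≤ q := fun i => by
    have h1 : K * (Finset.univ.sup fun i => N (f i)) ≤ n := by
      exact_mod_cast (le_max_right _ _).trans hn
    refine (Finset.le_sup (f := fun i => N (f i)) (Finset.mem_univ i)).trans ?_
    rw [hq, Nat.le_div_iff_mul_le hK, mul_comm]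
    exact h1
  have hmt : ∀ m : ℕ, q ≤ m → 2 ^ 14 ≤ (m : ℝ) * (1 - θ j₀) := fun m hm => by
    obtain ⟨_, _, -, -, -, -, -, h⟩ := hthr j₀
    refine (h (θ j₀) (hθ j₀)).trans ?_
    have : (N (f j₀) : ℝ) ≤ m := by exact_mod_cast (hNq j₀).trans hm
    have : 0 ≤ 1 - θ j₀ := by linarith
    gcongr
  have hq1 : (1 : ℝ) ≤ q := by
    have h := hmt q le_rfl
    have : q ≠ 0 := by
      rintro h0
      rw [h0] at h
      norm_num at h
    exact_mod_cast Nat.one_le_iff_ne_zero.2 this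
  have hm : ∀ m : ℕ, q ≤ m →
      L ^ 5 * ε ^ (-5 : ℤ) * Real.log (ε ^ (-5 : ℤ)) ≤ 2 * (m : ℝ) := fun m hqm => by
    have h1 := (le_max_left _ _).trans hn
    have h2 : (n : ℝ) < K * (q + 1) := by exact_mod_cast Nat.lt_mul_div_succ n hK
    have h3 : K * (L ^ 5 * ε ^ (-5 : ℤ) * Real.log (ε ^ (-5 : ℤ))) < K * ((q : ℝ) + 1) := by
      refine lt_of_le_of_lt (le_trans (le_of_eq ?_) h1) h2
      ring
    have h4 := lt_of_mul_lt_mul_left h3 hK0.le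
    have h5 : (q : ℝ) ≤ m := by exact_mod_cast hqm
    linarith
  set bad : Fin K → ℕ → Set Ω := fun i m =>
    {ω | ∃ z, ModalBandit.IsSampleMode (fun s : Fin m => X i s ω) z ∧ ε / 2 < |z - θ i|}
  have hbad : ∀ i, ∀ m ∈ ({q, q + 1} : Finset ℕ), μ.real (bad i m) ≤ δ / K / 2 := by
    intro i m hmem
    have hqm : q ≤ m := by
      simp only [Finset.mem_insert, Finset.mem_singleton] at hmem
      omega
    rw [← hexpL]
    exact (hthr i).measureReal_isSampleMode_le ((hNq i).trans hqm) (hθ i) hL hε hεt ht1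
      (hmt m hqm) (hm m hqm) (hX i) (hlaw i)
      (hind.precomp (g := fun s : ℕ => (i, s)) fun a b hab => (Prod.ext_iff.1 hab).2)
  -- the number of pulls is random, but takes only the two values `q` and `q + 1`
  set B : Set Ω := ⋃ i ∈ (Finset.univ : Finset (Fin K)), ⋃ m ∈ ({q, q + 1} : Finset ℕ), bad i m
  have hB : μ.real B ≤ δ := by
    calc μ.real B ≤ ∑ _i : Fin K, ∑ _m ∈ ({q, q + 1} : Finset ℕ), δ / K / 2 :=
          (measureReal_biUnion_finset_le _ _).trans (Finset.sum_le_sum fun i _ =>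
            (measureReal_biUnion_finset_le _ _).trans
              (Finset.sum_le_sum fun m hm => hbad i m hm))
      _ = δ := by
        simp [Finset.sum_const]
        field_simp
  have hcover : univ ⊆ B ∪ {ω | ∀ j, θ j - θ (best ω) ≤ ε} := by
    intro ω _
    by_contra hω
    simp only [mem_union, not_or] at hω
    refine hω.2 fun j => ?_
    have hclose : ∀ i, |θhat ω i - θ i| ≤ ε / 2 := fun i => by
      by_contra! hlt
      exact hω.1 (mem_iUnion₂.2 ⟨i, Finset.mem_univ i, mem_iUnion₂.2
        ⟨ModalBandit.pullCount (I ω) i n, (hI ω).pullCount_mem hK i, θhat ω i, hθhat ω i, hlt⟩⟩)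
    linarith [(abs_le.1 (hclose j)).1, (abs_le.1 (hclose (best ω))).2, hbest ω j]
  have := (measureReal_mono hcover).trans (measureReal_union_le (μ := μ) _ _)
  rw [probReal_univ] at this
  linarith
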